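/- Let $\mathbb{k}$ be a field, let $\mathcal V=\{\mathcal V(n)\}_{n\ge 1}$ be a collection of vector spaces with a fixed basis, and let $\mathcal F_{\mathcal V}$ be the free shuffle operad generated by $\mathcal V$. The space $\mathcal F_{\mathcal V}(n)$ has the basis of tree monomials with $n$ leaves: planar rooted trees whose leaves are bijectively labelled by $1,\dots,n$, in which each vertex with $j\ge 1$ inputs is decorated by a basis element of $\mathcal V(j)$, and in which at each vertex the smallest leaves reachable through the inputs increase from left to right. A tree monomial $\beta$ divides $\alpha$ if $\beta$ corresponds to a subtree of $\alpha$ which contains all inputs and the output of each of its vertices, the leaves of the subtree being numbered according to the smallest leaves of $\alpha$ above them (a single edge is a subtree without vertices). For $\alpha$ with $n$ leaves, $\beta$ with $m$ leaves, $1\le i\le n$ and an $(m-1,n-i)$-shuffle $\sigma$ of $\{i+1,\dots,m+n-1\}$, the elementary shuffle composition is $$\alpha\circ_{i,\sigma}\beta=\alpha(x_1,\dots,x_{i-1},\beta(x_i,x_{\sigma(i+1)},\dots,x_{\sigma(i+m-1)}),x_{\sigma(i+m)},\dots,x_{\sigma(m+n-1)}).$$ It is extended bilinearly; an ideal is a family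 of subspaces of the $\mathcal F_{\mathcal V}(n)$ closed under these compositions with arbitrary elements on either side. Fix a well-ordering of the tree monomials which is admissible: monomials with fewer leaves are smaller, and $\alpha\le\alpha'$, $\beta\le\beta'$ (with $\alpha,\alpha'$ of one arity and $\beta,\beta'$ of one arity) imply $\alpha\circ_{i,\sigma}\beta\le\alpha'\circ_{i,\sigma}\beta'$. Let $\mathcal M$ be an ideal of $\mathcal F_{\mathcal V}$ and $\mathcal P=\mathcal F_{\mathcal V}/\mathcal M$. A Gröbner basis of $\mathcal M$ is a set $\mathcal G$ of generators of the ideal $\mathcal M$, each of which belongs to some $\mathcal F_{\mathcal V}(n)$, such that the leading term of each nonzero element of $\mathcal M$ is divisible by the leading term of some nonzero element of $\mathcal G$. The normal monomials of $\mathcal G$ are the tree monomials which are not divisible by any leading term of a nonzero element of $\mathcal G$. A $k$-triangular basis of $\mathcal P$ is a set $B$ of tree monomials, containing the corollas of all basis elements of $\mathcal V$, such that 1. the images in $\mathcal P$ of the elements of $B$ form a basis of $\mathcal P$; 2. for $\alpha,\beta\in B$ and a shuffle $\sigma$, either $\alpha\circ_{i,\sigma}\beta\in B$, or all $\gamma\in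 B$ which appear in the expansion $\alpha\circ_{i,\sigma}\beta\equiv\sum_\gamma c_\gamma\gamma \pmod{\mathcal M}$ satisfy $\gamma<\alpha\circ_{i,\sigma}\beta$; 3. a tree monomial $\alpha$ is in $B$ if and only if every tree monomial with at most $k$ vertices which divides $\alpha$ is in $B$. A PBW basis of $\mathcal P$ in the sense of Hoffbeck (for the reversed ordering) is a set $B$ of tree monomials, containing the corollas of all basis elements of $\mathcal V$, which satisfies 1, 2 and the following condition: $\alpha\in B$ if and only if for each internal edge of $\alpha$ the tree monomial corresponding to the two-vertex subtree generated by that edge is in $B$. **Theorem.** (a) Let $\mathcal G$ be a Gröbner basis of $\mathcal M$ such that every leading term of $\mathcal G$ has at least two vertices. If $k$ is the maximal number of vertices in the leading terms of $\mathcal G$ (or any upper bound of these numbers), then the normal monomials of $\mathcal G$ form a $k$-triangular basis of $\mathcal P$. (b) Conversely, for each $k\ge 0$ and each $k$-triangular basis $B$ of $\mathcal P$ there is a Gröbner basis $\mathcal G$ of $\mathcal M$ whose set of normal monomials is $B$ and whose leading terms have at most $k$ vertices; moreover, all tree monomials which occur in elements of $\mathcal G$ have at most $k$ vertices if $\mathcal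 M$ is homogeneous with respect to the number of vertices, or if the ordering has the property that among the tree monomials of the same arity those with fewer vertices are smaller. (c) Suppose that $\mathcal P$ is quadratic, that is, $\mathcal M$ is generated by combinations of tree monomials with exactly two vertices. Then a set $B$ of tree monomials is a PBW basis of $\mathcal P$ if and only if it is a $2$-triangular basis of $\mathcal P$, and if and only if it is the set of normal monomials of a quadratic Gröbner basis of $\mathcal M$, that is, of a Gröbner basis all of whose elements are combinations of tree monomials with exactly two vertices. In particular, $\mathcal P$ has a PBW basis if and only if $\mathcal M$ has a quadratic Gröbner basis. -/

import Mathlib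

universe u v

namespace ShuffleOperad

/-- Planar rooted trees in which every vertex with `n ≥ 1` inputs carries an element of `X n` and
every leaf carries a natural number.  The type `X n` indexes the fixed basis of the component
`V(n)` of the collection of generators `V`. -/
inductive LTree (X : ℕ+ → Type u) : Type u
  | leaf (l : ℕ) : LTree X
  | node {n : ℕ+} (x : X n) (c : Fin n → LTree X) : LTree X

namespace LTree

variable {X : ℕ+ → Type u}

/-- The labels of the leaves, listed from left to right. -/
def leaves : LTree X → List ℕ
  | leaf l => [l]
  | node _ c => (List.ofFn fun i => (c i).leaves).flatten

/-- The number of vertices; leaves are not vertices. -/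
def vertices : LTree X → ℕ
  | leaf _ => 0
  | node _ c => 1 + ∑ i, (c i).vertices

/-- The smallest leaf label of `s` is smaller than the smallest leaf label of `t`. -/
def MinLt (s t : LTree X) : Prop := ∃ a ∈ s.leaves, ∀ b ∈ t.leaves, a < b

/-- The planar structure is the canonical one: at each vertex, the smallest leaves reachable
through the inputs increase from left to right. -/
def IsCanonical : LTree X → Prop
  | leaf _ => True
  | node _ c => (∀ i, (c i).IsCanonical) ∧ ∀ i j, i < j → MinLt (c i) (c j)

/-- Substitution of the trees `f l` for the leaves labelled `l`. -/
def subst : LTree X → (ℕ → LTree X) → LTree X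
  | leaf l, f => f l
  | node x c, f => node x fun i => (c i).subst f

/-- Relabelling of the leaves. -/
def relabel (t : LTree X) (f : ℕ → ℕ) : LTree X := t.subst fun l => leaf (f l)

/-- `IsBranch s t`: the tree `s` consists of an edge of `t` and everything above it. -/
def IsBranch (s : LTree X) : LTree X → Prop
  | leaf l => s = leaf l
  | node x c => s = node x c ∨ ∃ i, IsBranch s (c i)

/-- The elementary composition `α(x_{σ(1)}, …, β(x_{σ(i)}, …, x_{σ(i+m-1)}), …, x_{σ(m+n-1)})`
of a tree `α` and a tree `β` with `m` leaves; for a shuffle `σ` one has `σ(j) = j` for `j ≤ i`. -/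
def comp (α β : LTree X) (m i : ℕ) (σ : Equiv.Perm ℕ) : LTree X :=
  α.subst fun j =>
    if j < i then leaf (σ j)
    else if j = i then β.relabel fun l => σ (i + l - 1)
    else leaf (σ (j + m - 1))

/-- A canonical planar tree with leaves bijectively labelled by `1, …, n`. -/
structure IsMonomial (n : ℕ) (t : LTree X) : Prop where
  canonical : t.IsCanonical
  nodup : t.leaves.Nodup
  mem_leaves : ∀ l, l ∈ t.leaves ↔ 1 ≤ l ∧ l ≤ n

theorem leaves_ne_nil (t : LTree X) : t.leaves ≠ [] := by
  induction t with
  | leaf l => simp [leaves]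
  | node x c ih =>
    intro h
    rw [leaves, List.flatten_eq_nil_iff] at h
    exact ih ⟨0, PNat.pos _⟩ (h _ (by simp))

theorem exists_min_leaf (t : LTree X) : ∃ a ∈ t.leaves, ∀ b ∈ t.leaves, a ≤ b := by
  obtain ⟨l, hl⟩ := List.exists_mem_of_ne_nil _ t.leaves_ne_nil
  have h : ∃ a, a ∈ t.leaves := ⟨l, hl⟩
  classical
  exact ⟨Nat.find h, Nat.find_spec h, fun b hb => Nat.find_min' h hb⟩

theorem leaves_subst (t : LTree X) (f : ℕ → LTree X) :
    (t.subst f).leaves = t.leaves.flatMap fun l => (f l).leaves := by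
  induction t with
  | leaf l => simp [subst, leaves]
  | node x c ih =>
    simp only [subst, leaves, ih, List.flatMap, List.map_flatten, List.flatten_flatten,
      List.map_ofFn, Function.comp_def]

theorem leaves_relabel (t : LTree X) (f : ℕ → ℕ) : (t.relabel f).leaves = t.leaves.map f := by
  rw [relabel, leaves_subst]
  simp [leaves, ← List.map_eq_flatMap]

theorem IsCanonical.subst {t : LTree X} (ht : t.IsCanonical) {f : ℕ → LTree X}
    (hf : ∀ l ∈ t.leaves, (f l).IsCanonical)
    (hlt : ∀ l ∈ t.leaves, ∀ l' ∈ t.leaves, l < l' → MinLt (f l) (f l')) :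
    (t.subst f).IsCanonical := by
  induction t with
  | leaf l => exact hf l (by simp [leaves])
  | node x c ih =>
    have hmem : ∀ i, ∀ l ∈ (c i).leaves, l ∈ (node x c).leaves := by
      intro i l hl
      simp only [leaves, List.mem_flatten, List.mem_ofFn]
      exact ⟨_, ⟨i, rfl⟩, hl⟩
    refine ⟨fun i => ih i (ht.1 i) (fun l hl => hf l (hmem i l hl))
      (fun l hl l' hl' => hlt l (hmem i l hl) l' (hmem i l' hl')), fun i j hij => ?_⟩
    obtain ⟨a, ha, hab⟩ := ht.2 i j hij
    obtain ⟨p, hp, hpmin⟩ := (f a).exists_min_leaf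
    refine ⟨p, ?_, fun q hq => ?_⟩
    · rw [leaves_subst, List.mem_flatMap]
      exact ⟨a, ha, hp⟩
    · rw [leaves_subst, List.mem_flatMap] at hq
      obtain ⟨b, hb, hq⟩ := hq
      obtain ⟨p', hp', hlt'⟩ := hlt a (hmem i a ha) b (hmem j b hb) (hab b hb)
      exact lt_of_le_of_lt (hpmin p' hp') (hlt' q hq)

end LTree

/-- `σ` is an `(m-1, n-i)`-shuffle of `{i+1, …, m+n-1}`, extended by the identity. -/
structure IsShuffle (n m i : ℕ) (σ : Equiv.Perm ℕ) : Prop where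
  one_le : 1 ≤ i
  le : i ≤ n
  fixes : ∀ j, ¬ (i + 1 ≤ j ∧ j ≤ m + n - 1) → σ j = j
  mono_left : StrictMonoOn σ (Set.Icc (i + 1) (i + m - 1))
  mono_right : StrictMonoOn σ (Set.Icc (i + m) (m + n - 1))

theorem IsShuffle.maps {n m i : ℕ} {σ : Equiv.Perm ℕ} (h : IsShuffle n m i σ) (j : ℕ) :
    (i + 1 ≤ σ j ∧ σ j ≤ m + n - 1) ↔ (i + 1 ≤ j ∧ j ≤ m + n - 1) := by
  constructor
  · intro hj
    by_contra hn
    rw [h.fixes j hn] at hj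
    exact hn hj
  · intro hj
    by_contra hn
    have := σ.injective (h.fixes (σ j) hn)
    rw [this] at hn
    exact hn hj

/-- Tree monomials with `n` leaves. -/
def TreeMonomial (X : ℕ+ → Type u) (n : ℕ) : Type u := {t : LTree X // t.IsMonomial n}

namespace TreeMonomial

variable {X : ℕ+ → Type u} {n m : ℕ}

def vertices (a : TreeMonomial X n) : ℕ := a.1.vertices

theorem pos (a : TreeMonomial X n) : 1 ≤ n := by
  obtain ⟨l, hl⟩ := List.exists_mem_of_ne_nil _ a.1.leaves_ne_nil
  have := (a.2.mem_leaves l).1 hl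
  omega

theorem isMonomial_corolla {k : ℕ+} (x : X k) :
    (LTree.node x fun i => LTree.leaf (i + 1 : ℕ)).IsMonomial k := by
  have hl : (LTree.node x fun i => LTree.leaf (i + 1 : ℕ)).leaves
      = List.ofFn fun i : Fin k => (i + 1 : ℕ) := by
    simp only [LTree.leaves]
    rw [show (fun i : Fin k => [(i + 1 : ℕ)]) = (fun a => [a]) ∘ fun i : Fin k => (i + 1 : ℕ)
      from rfl, ← List.map_ofFn, ← List.flatMap_def, List.flatMap_singleton']
  refine ⟨⟨fun _ => trivial, fun i j hij => ?_⟩, ?_, fun l => ?_⟩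
  · simpa [LTree.MinLt, LTree.leaves] using hij
  · rw [hl, List.nodup_ofFn]
    intro i j hij
    ext
    simpa using hij
  · rw [hl, List.mem_ofFn]
    constructor
    · rintro ⟨i, rfl⟩
      have := i.2
      omega
    · rintro ⟨h1, h2⟩
      exact ⟨⟨l - 1, by omega⟩, by simp only; omega⟩

/-- The corolla of a generator. -/
def corolla {k : ℕ+} (x : X k) : TreeMonomial X k :=
  ⟨.node x fun i => .leaf (i + 1), isMonomial_corolla x⟩

theorem isMonomial_comp (a : TreeMonomial X n) (b : TreeMonomial X m) {i : ℕ} {σ : Equiv.Perm ℕ}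
    (h : IsShuffle n m i σ) : (a.1.comp b.1 m i σ).IsMonomial (n + m - 1) := by
  have hm := b.pos
  have hi := h.one_le
  have hin := h.le
  have hσi : ∀ j, j ≤ i → σ j = j := fun j hj => h.fixes j (by omega)
  have hσ : ∀ j, (1 ≤ σ j ∧ σ j ≤ n + m - 1) ↔ (1 ≤ j ∧ j ≤ n + m - 1) := by
    intro j
    by_cases hj : i + 1 ≤ j ∧ j ≤ m + n - 1
    · have := (h.maps j).2 hj
      omega
    · rw [h.fixes j hj]
  have hgt : ∀ j, i < j → i < σ j := by
    intro j hj
    by_cases hj' : i + 1 ≤ j ∧ j ≤ m + n - 1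
    · have := (h.maps j).2 hj'
      omega
    · rwa [h.fixes j hj']
  have hleaf : ∀ j, ((if j < i then LTree.leaf (σ j)
      else if j = i then b.1.relabel fun l => σ (i + l - 1)
      else LTree.leaf (σ (j + m - 1)) : LTree X)).leaves
      = if j < i then [σ j] else if j = i then b.1.leaves.map (fun l => σ (i + l - 1))
        else [σ (j + m - 1)] := by
    intro j
    split_ifs <;> simp [LTree.leaves, LTree.leaves_relabel]
  refine ⟨?_, ?_, fun l => ?_⟩
  · refine a.2.canonical.subst (fun j _ => ?_) (fun j hj j' hj' hjj => ?_)
    · split_ifs with h1 h2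
      · trivial
      · refine b.2.canonical.subst (fun _ _ => trivial) (fun l hl l' hl' hll => ?_)
        have h1 := (b.2.mem_leaves l).1 hl
        have h2 := (b.2.mem_leaves l').1 hl'
        simp only [LTree.MinLt, LTree.leaves, List.mem_singleton, exists_eq_left, forall_eq]
        rcases Nat.lt_or_ge 1 l with h3 | h3
        · exact h.mono_left (by simp only [Set.mem_Icc]; omega)
            (by simp only [Set.mem_Icc]; omega) (by omega)
        · rw [hσi (i + l - 1) (by omega)]
          have := hgt (i + l' - 1) (by omega)
          omega
      · trivial
    · have h1 := (a.2.mem_leaves j).1 hj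
      have h2 := (a.2.mem_leaves j').1 hj'
      have hone : 1 ∈ b.1.leaves := (b.2.mem_leaves 1).2 ⟨le_rfl, hm⟩
      simp only [LTree.MinLt, hleaf]
      rcases lt_trichotomy j i with h3 | h3 | h3
      · refine ⟨j, by simp [h3, hσi j h3.le], fun q hq => ?_⟩
        rcases lt_trichotomy j' i with h4 | h4 | h4
        · simp only [h4, if_true, List.mem_singleton] at hq
          rw [hq, hσi j' h4.le]
          exact hjj
        · simp only [h4, lt_irrefl, if_false, if_true, List.mem_map] at hq
          obtain ⟨l, hl, rfl⟩ := hq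
          have hl := (b.2.mem_leaves l).1 hl
          rcases Nat.lt_or_ge 1 l with h5 | h5
          · have := hgt (i + l - 1) (by omega)
            omega
          · rw [hσi (i + l - 1) (by omega)]
            omega
        · simp only [h4.not_gt, h4.ne', if_false, List.mem_singleton] at hq
          have := hgt (j' + m - 1) (by omega)
          omega
      · subst h3
        refine ⟨j, ?_, fun q hq => ?_⟩
        · simp only [lt_irrefl, if_false, if_true, List.mem_map]
          exact ⟨1, hone, by rw [Nat.add_sub_cancel]; exact hσi j le_rfl⟩
        · simp only [hjj.not_gt, hjj.ne', if_false, List.mem_singleton] at hq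
          rw [hq]
          exact hgt _ (by omega)
      · have h4 : i < j' := h3.trans hjj
        simp only [h3.not_gt, h3.ne', h4.not_gt, h4.ne', if_false, List.mem_singleton,
          exists_eq_left, forall_eq]
        exact h.mono_right (by simp only [Set.mem_Icc]; omega)
          (by simp only [Set.mem_Icc]; omega) (by omega)
  · rw [LTree.comp, LTree.leaves_subst, List.nodup_flatMap]
    constructor
    · intro j _
      rw [hleaf]
      split_ifs
      · simp
      · refine (List.nodup_map_iff_inj_on b.2.nodup).2 (fun l hl l' hl' hll => ?_)
        have h1 := (b.2.mem_leaves l).1 hl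
        have h2 := (b.2.mem_leaves l').1 hl'
        have := σ.injective hll
        omega
      · simp
    · refine (List.pairwise_iff_forall_sublist.2 ?_)
      intro j j' hs
      have hne : j ≠ j' := by
        have := a.2.nodup.sublist hs
        simpa using this
      have aux : ∀ j q, q ∈ (if j < i then [σ j] else
          if j = i then b.1.leaves.map (fun l => σ (i + l - 1)) else [σ (j + m - 1)]) →
          ∃ p, q = σ p ∧ (j < i → p = j) ∧ (j = i → i ≤ p ∧ p ≤ i + m - 1) ∧
            (i < j → p = j + m - 1) := by
        intro j q hq
        split_ifs at hq with h1 h2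
        · exact ⟨j, by simpa using hq, by omega, by omega, by omega⟩
        · obtain ⟨l, hl, rfl⟩ := List.mem_map.1 hq
          have hl := (b.2.mem_leaves l).1 hl
          exact ⟨i + l - 1, rfl, by omega, by omega, by omega⟩
        · exact ⟨j + m - 1, by simpa using hq, by omega, by omega, by omega⟩
      simp only [Function.onFun, hleaf]
      intro q hq hq'
      obtain ⟨p, rfl, hp⟩ := aux j q hq
      obtain ⟨p', hpp, hp'⟩ := aux j' _ hq'
      have := σ.injective hpp
      omega
  · rw [LTree.comp, LTree.leaves_subst, List.mem_flatMap]
    simp only [hleaf]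
    constructor
    · rintro ⟨j, hj, hq⟩
      have h1 := (a.2.mem_leaves j).1 hj
      split_ifs at hq with h2 h3
      · rw [List.mem_singleton.1 hq]
        exact (hσ j).2 (by omega)
      · obtain ⟨l, hl, rfl⟩ := List.mem_map.1 hq
        have hl := (b.2.mem_leaves l).1 hl
        exact (hσ _).2 (by omega)
      · rw [List.mem_singleton.1 hq]
        exact (hσ _).2 (by omega)
    · intro hl
      obtain ⟨p, rfl⟩ := σ.surjective l
      have hp := (hσ p).1 hl
      rcases Nat.lt_or_ge p i with h1 | h1
      · exact ⟨p, (a.2.mem_leaves p).2 (by omega), by simp [h1]⟩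
      rcases Nat.lt_or_ge p (i + m) with h2 | h2
      · refine ⟨i, (a.2.mem_leaves i).2 (by omega), ?_⟩
        simp only [lt_irrefl, if_false, if_true, List.mem_map]
        refine ⟨p + 1 - i, (b.2.mem_leaves _).2 (by omega), ?_⟩
        congr 1
        omega
      · refine ⟨p + 1 - m, (a.2.mem_leaves _).2 (by omega), ?_⟩
        rw [if_neg (by omega), if_neg (by omega), List.mem_singleton]
        congr 1
        omega

/-- The elementary shuffle composition `a ∘_{i,σ} b`. -/
def comp (a : TreeMonomial X n) (b : TreeMonomial X m) {i : ℕ} {σ : Equiv.Perm ℕ}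
    (h : IsShuffle n m i σ) : TreeMonomial X (n + m - 1) :=
  ⟨a.1.comp b.1 m i σ, isMonomial_comp a b h⟩

/-- `b.Divides a`: the tree monomial `b` is the one that corresponds to a subtree of `a`.  The
subtree sits at the bottom of a branch of `a`; the trees `f j` are what remains of that branch above
the leaves of the subtree, and these leaves are numbered by their smallest descendants. -/
def Divides (b : TreeMonomial X m) (a : TreeMonomial X n) : Prop :=
  ∃ f : ℕ → LTree X, (b.1.subst f).IsBranch a.1 ∧
    ∀ j j', 1 ≤ j → j < j' → j' ≤ m → (f j).MinLt (f j')

end TreeMonomial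

/-- A linear ordering of all tree monomials which is admissible. -/
structure AdmissibleOrder (X : ℕ+ → Type u) where
  le : (Σ n, TreeMonomial X n) → (Σ n, TreeMonomial X n) → Prop
  le_refl : ∀ a, le a a
  le_trans : ∀ a b c, le a b → le b c → le a c
  le_antisymm : ∀ a b, le a b → le b a → a = b
  le_total : ∀ a b, le a b ∨ le b a
  /-- Monomials of smaller arity are smaller. -/
  le_of_arity_lt : ∀ {n m : ℕ} (a : TreeMonomial X n) (b : TreeMonomial X m),
    n < m → le ⟨n, a⟩ ⟨m, b⟩
  /-- Shuffle compositions are monotone. -/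
  comp_le_comp : ∀ {n m : ℕ} (a a' : TreeMonomial X n) (b b' : TreeMonomial X m) {i : ℕ}
    {σ : Equiv.Perm ℕ} (h : IsShuffle n m i σ), le ⟨n, a⟩ ⟨n, a'⟩ → le ⟨m, b⟩ ⟨m, b'⟩ →
    le ⟨n + m - 1, a.comp b h⟩ ⟨n + m - 1, a'.comp b' h⟩

namespace AdmissibleOrder

variable {X : ℕ+ → Type u}

def lt (ord : AdmissibleOrder X) (a b : Σ n, TreeMonomial X n) : Prop := ord.le a b ∧ a ≠ b

/-- Among the tree monomials of the same arity, those with fewer vertices are smaller. -/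
def IsVertexGraded (ord : AdmissibleOrder X) : Prop :=
  ∀ (n : ℕ) (a b : TreeMonomial X n), a.vertices < b.vertices → ord.lt ⟨n, a⟩ ⟨n, b⟩

end AdmissibleOrder

section Linear

variable {K : Type v} [Field K] {X : ℕ+ → Type u} {n m : ℕ}

/-- The component of arity `n` of the free shuffle operad: the vector space with basis the tree
monomials with `n` leaves. -/
abbrev FreeOperad (K : Type v) [Field K] (X : ℕ+ → Type u) (n : ℕ) : Type (max u v) :=
  TreeMonomial X n →₀ K

/-- The elementary shuffle composition `f ∘_{i,σ} g`, bilinear in `f` and `g`. -/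
noncomputable def FreeOperad.comp (f : FreeOperad K X n) (g : FreeOperad K X m) {i : ℕ}
    {σ : Equiv.Perm ℕ} (h : IsShuffle n m i σ) : FreeOperad K X (n + m - 1) :=
  f.sum fun a c => g.sum fun b d => Finsupp.single (a.comp b h) (c * d)

/-- Two-sided ideals of the free shuffle operad. -/
structure OperadIdeal (K : Type v) [Field K] (X : ℕ+ → Type u) where
  carrier : ∀ n, Submodule K (FreeOperad K X n)
  comp_mem_left : ∀ {n m i : ℕ} {σ : Equiv.Perm ℕ} (h : IsShuffle n m i σ)
    (f : FreeOperad K X n) (g : FreeOperad K X m), f ∈ carrier n →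
    f.comp g h ∈ carrier (n + m - 1)
  comp_mem_right : ∀ {n m i : ℕ} {σ : Equiv.Perm ℕ} (h : IsShuffle n m i σ)
    (f : FreeOperad K X n) (g : FreeOperad K X m), g ∈ carrier m →
    f.comp g h ∈ carrier (n + m - 1)

/-- `M` is the smallest ideal that contains the system `G` of (arity-)homogeneous elements. -/
def OperadIdeal.IsGeneratedBy (M : OperadIdeal K X) (G : ∀ n, Set (FreeOperad K X n)) : Prop :=
  (∀ n, ∀ g ∈ G n, g ∈ M.carrier n) ∧
    ∀ N : OperadIdeal K X, (∀ n, ∀ g ∈ G n, g ∈ N.carrier n) →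
      ∀ n, M.carrier n ≤ N.carrier n

/-- All tree monomials that occur in elements of `G` have exactly two vertices. -/
def IsQuadraticSystem (G : ∀ n, Set (FreeOperad K X n)) : Prop :=
  ∀ n, ∀ g ∈ G n, ∀ t ∈ g.support, t.vertices = 2

/-- The ideal of relations of a quadratic operad. -/
def OperadIdeal.IsQuadratic (M : OperadIdeal K X) : Prop :=
  ∃ R : ∀ n, Set (FreeOperad K X n), IsQuadraticSystem R ∧ M.IsGeneratedBy R

/-- The ideal is homogeneous with respect to the number of vertices of tree monomials. -/
def OperadIdeal.IsVertexHomogeneous (M : OperadIdeal K X) : Prop :=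
  ∀ n, ∀ f ∈ M.carrier n, ∀ d : ℕ,
    ∃ g ∈ M.carrier n, ∀ t : TreeMonomial X n,
      (t.vertices = d → g t = f t) ∧ (t.vertices ≠ d → g t = 0)

/-- `t` is the leading term of `f`; the zero element has none. -/
def IsLeadingTerm (ord : AdmissibleOrder X) (f : FreeOperad K X n) (t : TreeMonomial X n) : Prop :=
  t ∈ f.support ∧ ∀ s ∈ f.support, ord.le ⟨n, s⟩ ⟨n, t⟩

/-- `G` is a system of homogeneous generators of `M` and the leading term of every (nonzero) element
of `M` is divisible by the leading term of some element of `G`. -/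
structure IsGroebnerBasis (ord : AdmissibleOrder X) (M : OperadIdeal K X)
    (G : ∀ n, Set (FreeOperad K X n)) : Prop where
  generates : M.IsGeneratedBy G
  divides : ∀ n, ∀ f ∈ M.carrier n, ∀ t, IsLeadingTerm ord f t →
    ∃ m, ∃ g ∈ G m, ∃ s, IsLeadingTerm ord g s ∧ s.Divides t

/-- The tree monomials which are not divisible by leading terms of elements of `G`. -/
def normalMonomials (ord : AdmissibleOrder X) (G : ∀ n, Set (FreeOperad K X n)) (n : ℕ) :
    Set (TreeMonomial X n) :=
  {a | ¬ ∃ m, ∃ g ∈ G m, ∃ s, IsLeadingTerm ord g s ∧ s.Divides a}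

/-- The images of the tree monomials in `B` form a basis of the quotient `F_V / M`. -/
def IsQuotientBasis (M : OperadIdeal K X) (B : ∀ n, Set (TreeMonomial X n)) : Prop :=
  ∀ n, LinearIndependent K
      (fun b : B n => (M.carrier n).mkQ (Finsupp.single (b : TreeMonomial X n) (1 : K))) ∧
    Submodule.span K (Set.range
      fun b : B n => (M.carrier n).mkQ (Finsupp.single (b : TreeMonomial X n) (1 : K))) = ⊤

/-- For `α, β ∈ B` and a shuffle `σ`, either `α ∘_{i,σ} β` is in `B`, or the elements of `B` which
appear in an expansion `α ∘_{i,σ} β = ∑ c_γ γ + M` are smaller than `α ∘_{i,σ} β`. -/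
def HasTriangularCompositions (ord : AdmissibleOrder X) (M : OperadIdeal K X)
    (B : ∀ n, Set (TreeMonomial X n)) : Prop :=
  ∀ (n m i : ℕ) (σ : Equiv.Perm ℕ) (h : IsShuffle n m i σ), ∀ a ∈ B n, ∀ b ∈ B m,
    a.comp b h ∈ B (n + m - 1) ∨
      ∀ f : FreeOperad K X (n + m - 1), (∀ t ∈ f.support, t ∈ B (n + m - 1)) →
        Finsupp.single (a.comp b h) 1 - f ∈ M.carrier (n + m - 1) →
        ∀ t ∈ f.support, ord.lt ⟨n + m - 1, t⟩ ⟨n + m - 1, a.comp b h⟩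

/-- `B` is a `k`-triangular basis of the operad `F_V / M`. -/
structure IsTriangularBasis (ord : AdmissibleOrder X) (M : OperadIdeal K X) (k : ℕ)
    (B : ∀ n, Set (TreeMonomial X n)) : Prop where
  corolla_mem : ∀ (n : ℕ+) (x : X n), TreeMonomial.corolla x ∈ B n
  basis : IsQuotientBasis M B
  triangular : HasTriangularCompositions ord M B
  mem_iff : ∀ n (a : TreeMonomial X n), a ∈ B n ↔
    ∀ m (b : TreeMonomial X m), b.vertices ≤ k → b.Divides a → b ∈ B m

/-- `B` is a PBW basis of the operad `F_V / M` in the sense of Hoffbeck, for the reversed ordering.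
The last condition concerns the subtrees of `a` generated by its internal edges: these are exactly
the subtrees with two vertices. -/
structure IsPBWBasis (ord : AdmissibleOrder X) (M : OperadIdeal K X)
    (B : ∀ n, Set (TreeMonomial X n)) : Prop where
  corolla_mem : ∀ (n : ℕ+) (x : X n), TreeMonomial.corolla x ∈ B n
  basis : IsQuotientBasis M B
  triangular : HasTriangularCompositions ord M B
  mem_iff : ∀ n (a : TreeMonomial X n), a ∈ B n ↔
    ∀ m (b : TreeMonomial X m), b.vertices = 2 → b.Divides a → b ∈ B m

end Linear

end ShuffleOperad

/-! The combinatorial bridge is that divisibility means insertion. If `s` divides `t`, then `t = φ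
s` for a map `φ` built from elementary compositions with fixed monomials (`Divides.exists_isGraft`).
Such a `φ` preserves ideals (`OperadIdeal.mapDomain_mem`) and is strictly monotone for an admissible
ordering (`IsGraft.lt`). Hence a monomial divisible by a leading term is, modulo the ideal, a
combination of smaller monomials, and well-founded induction rewrites every `t` as a combination of
normal monomials `≤ t` (`single_mem_sup_supported`, `mem_sup_supported`).

(a) A nonzero element of `M` has a leading term that is not normal, so normal monomials are
independent modulo `M`; by reduction they span. Expansions are therefore unique and coincide with
those produced by reduction, which involve no larger monomials: this is triangularity. The local
condition follows from transitivity of divisibility and the bound on leading terms.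

(b) Take all minimal monomials `t` outside `B` and the relations `t - e`, where `e` is the expansion
of `t` in `B`. The local condition makes `B` closed under divisors and forces `t` to have at most
`k` vertices. If `t` has at least two vertices, it is a composition of two proper divisors, which
lie in `B` by minimality, so triangularity makes `t` the leading term (`lt_of_mem_support`); smaller
`t` have no terms in their expansion. Thus `B` is the set of normal monomials, and reduction
combined with independence of `B` modulo `M` shows that the relations generate `M` and form a
Gröbner basis.

(c) A quadratic ideal is homogeneous in the number of vertices and involves no monomial with fewer
than two vertices. So the trivial tree and the corollas always belong to `B`, the two local
conditions agree for `k = 2`, and the relations of (b) involve only trees with exactly two vertices.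
-/

namespace ShuffleOperad

namespace LTree

variable {X : ℕ+ → Type u}

/-! ### The smallest leaf -/

/-- The smallest leaf label. -/
noncomputable def minLeaf (t : LTree X) : ℕ := sInf {l | l ∈ t.leaves}

theorem minLeaf_mem (t : LTree X) : t.minLeaf ∈ t.leaves := by
  obtain ⟨a, ha, -⟩ := t.exists_min_leaf
  exact Nat.sInf_mem (s := {l | l ∈ t.leaves}) ⟨a, ha⟩

theorem minLeaf_le {t : LTree X} {l : ℕ} (h : l ∈ t.leaves) : t.minLeaf ≤ l :=
  Nat.sInf_le (s := {l | l ∈ t.leaves}) h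

theorem minLeaf_eq {t : LTree X} {p : ℕ} (hp : p ∈ t.leaves) (h : ∀ q ∈ t.leaves, p ≤ q) :
    t.minLeaf = p :=
  le_antisymm (minLeaf_le hp) (h _ t.minLeaf_mem)

@[simp] theorem minLeaf_leaf (l : ℕ) : (leaf l : LTree X).minLeaf = l :=
  minLeaf_eq (by simp [leaves]) (by simp [leaves])

theorem minLt_iff {s t : LTree X} : s.MinLt t ↔ s.minLeaf < t.minLeaf :=
  ⟨fun ⟨_, ha, h⟩ => (minLeaf_le ha).trans_lt (h _ t.minLeaf_mem),
    fun h => ⟨_, s.minLeaf_mem, fun _ hb => h.trans_le (minLeaf_le hb)⟩⟩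

theorem mem_leaves_subst {t : LTree X} {f : ℕ → LTree X} {q : ℕ} :
    q ∈ (t.subst f).leaves ↔ ∃ l ∈ t.leaves, q ∈ (f l).leaves := by
  rw [leaves_subst, List.mem_flatMap]

theorem mem_leaves_node {n : ℕ+} {x : X n} {c : Fin n → LTree X} {l : ℕ} :
    l ∈ (node x c).leaves ↔ ∃ i, l ∈ (c i).leaves := by
  simp only [leaves, List.mem_flatten, List.mem_ofFn]
  exact ⟨fun ⟨_, ⟨i, hi⟩, h⟩ => ⟨i, hi ▸ h⟩, fun ⟨i, h⟩ => ⟨_, ⟨i, rfl⟩, h⟩⟩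

/-- Substituting trees with increasing smallest leaves preserves the order of smallest leaves. -/
theorem MinLt.subst {s t : LTree X} (h : s.MinLt t) {f : ℕ → LTree X}
    (hf : ∀ l ∈ s.leaves, ∀ l' ∈ t.leaves, l < l' → (f l).MinLt (f l')) :
    (s.subst f).MinLt (t.subst f) := by
  obtain ⟨a, ha, hab⟩ := h
  refine ⟨(f a).minLeaf, mem_leaves_subst.2 ⟨a, ha, minLeaf_mem _⟩, fun q hq => ?_⟩
  obtain ⟨l, hl, hq⟩ := mem_leaves_subst.1 hq
  exact (minLt_iff.1 (hf a ha l hl (hab l hl))).trans_le (minLeaf_le hq)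

theorem minLeaf_subst {t : LTree X} {f : ℕ → LTree X} (hf : ∀ l ∈ t.leaves, (f l).minLeaf = l) :
    (t.subst f).minLeaf = t.minLeaf := by
  refine minLeaf_eq (mem_leaves_subst.2 ⟨_, t.minLeaf_mem, ?_⟩) fun q hq => ?_
  · have := (f t.minLeaf).minLeaf_mem
    rwa [hf _ t.minLeaf_mem] at this
  · obtain ⟨l, hl, hq⟩ := mem_leaves_subst.1 hq
    exact (minLeaf_le hl).trans ((hf l hl).symm.le.trans (minLeaf_le hq))

/-! ### Substitution -/

theorem subst_subst (t : LTree X) (f g : ℕ → LTree X) :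
    (t.subst f).subst g = t.subst fun l => (f l).subst g := by
  induction t with
  | leaf l => rfl
  | node x c ih => simp only [subst, ih]

theorem subst_congr {t : LTree X} {f g : ℕ → LTree X} (h : ∀ l ∈ t.leaves, f l = g l) :
    t.subst f = t.subst g := by
  induction t with
  | leaf l => exact h l (by simp [leaves])
  | node x c ih =>
    simp only [subst]
    congr 1
    funext i
    exact ih i fun l hl => h l (mem_leaves_node.2 ⟨i, hl⟩)

theorem eq_of_subst_eq {t : LTree X} {f g : ℕ → LTree X} (h : t.subst f = t.subst g) :
    ∀ l ∈ t.leaves, f l = g l := by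
  induction t with
  | leaf l => simpa [leaves, subst] using h
  | node x c ih =>
    intro l hl
    obtain ⟨i, hi⟩ := mem_leaves_node.1 hl
    simp only [subst, node.injEq, heq_eq_eq, true_and] at h
    exact ih i (congrFun h i) l hi

theorem subst_leaf (t : LTree X) : t.subst leaf = t := by
  induction t with
  | leaf l => rfl
  | node x c ih => simp only [subst, ih]

theorem subst_update_of_notMem {t s : LTree X} {p : ℕ} (h : p ∉ t.leaves) :
    t.subst (Function.update leaf p s) = t := by
  conv_rhs => rw [← t.subst_leaf]
  exact subst_congr fun l hl => Function.update_of_ne (ne_of_mem_of_not_mem hl h) _ _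

theorem vertices_subst (t : LTree X) (f : ℕ → LTree X) :
    (t.subst f).vertices = t.vertices + (t.leaves.map fun l => (f l).vertices).sum := by
  induction t with
  | leaf l => simp [subst, vertices, leaves]
  | node x c ih =>
    simp only [subst, vertices, ih, leaves, List.map_flatten, List.sum_flatten, List.map_ofFn,
      Finset.sum_add_distrib, add_assoc, List.sum_ofFn, Function.comp_def]

theorem vertices_relabel (t : LTree X) (f : ℕ → ℕ) : (t.relabel f).vertices = t.vertices := by
  simp [relabel, vertices_subst, vertices]

theorem vertices_le_subst (t : LTree X) (f : ℕ → LTree X) :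
    t.vertices ≤ (t.subst f).vertices := by
  rw [vertices_subst]
  exact Nat.le_add_right _ _

theorem vertices_le_subst_of_mem {t : LTree X} (f : ℕ → LTree X) {l : ℕ} (hl : l ∈ t.leaves) :
    t.vertices + (f l).vertices ≤ (t.subst f).vertices := by
  rw [vertices_subst]
  exact Nat.add_le_add_left (List.single_le_sum (by simp) _
    (List.mem_map_of_mem (f := fun l => (f l).vertices) hl)) _

theorem eq_leaf_of_vertices_eq_zero {t : LTree X} (h : t.vertices = 0) : ∃ l, t = leaf l := by
  cases t with
  | leaf l => exact ⟨l, rfl⟩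
  | node x c => simp [vertices] at h

/-- Substitution of trees with pairwise disjoint sets of leaves is injective. -/
theorem subst_injective {f : ℕ → LTree X}
    (hf : ∀ l l' q, q ∈ (f l).leaves → q ∈ (f l').leaves → l = l') :
    Function.Injective fun t : LTree X => t.subst f := by
  -- An equality would give `f l` a leaf in common with `f l'` for a leaf `l'` of the node, so `l =
  -- l'`. Then `f l` would contain itself above a vertex, contradicting the vertex count.
  have key : ∀ (l : ℕ) {n : ℕ+} (x : X n) (c : Fin n → LTree X),
      f l ≠ (node x c).subst f := by
    intro l n x c h
    obtain ⟨l', hl'⟩ := List.exists_mem_of_ne_nil _ (node x c).leaves_ne_nil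
    obtain ⟨q, hq⟩ := List.exists_mem_of_ne_nil _ (f l').leaves_ne_nil
    have hl : l = l' := hf l l' q (h ▸ mem_leaves_subst.2 ⟨l', hl', hq⟩) hq
    subst hl
    have := vertices_le_subst_of_mem f hl'
    rw [← h] at this
    simp [vertices] at this
  intro t
  induction t with
  | leaf l =>
    intro t' h
    cases t' with
    | leaf l' =>
      obtain ⟨q, hq⟩ := List.exists_mem_of_ne_nil _ (f l).leaves_ne_nil
      have h' : f l = f l' := h
      rw [hf l l' q hq (h' ▸ hq)]
    | node x c => exact absurd h (key l x c)
  | node x c ih =>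
    intro t' h
    cases t' with
    | leaf l' => exact absurd h.symm (key l' x c)
    | node x' c' =>
      simp only [subst, node.injEq] at h
      obtain ⟨rfl, hx, hc⟩ := h
      obtain rfl := eq_of_heq hx
      congr 1
      funext i
      exact ih i (congrFun (eq_of_heq hc) i)

theorem relabel_injective {e : ℕ → ℕ} (he : Function.Injective e) :
    Function.Injective fun t : LTree X => t.relabel e :=
  subst_injective fun l l' q h h' => by
    simp only [leaves, List.mem_singleton] at h h'
    exact he (h.symm.trans h')

theorem nodup_of_nodup_subst {t : LTree X} {f : ℕ → LTree X} (h : (t.subst f).leaves.Nodup) :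
    t.leaves.Nodup ∧ (∀ l ∈ t.leaves, (f l).leaves.Nodup) ∧
      ∀ l ∈ t.leaves, ∀ l' ∈ t.leaves, l ≠ l' → ∀ q ∈ (f l).leaves, q ∉ (f l').leaves := by
  rw [leaves_subst, List.nodup_flatMap] at h
  refine ⟨h.2.imp ?_, h.1, fun l hl l' hl' hne q hq hq' => ?_⟩
  · rintro a b hab rfl
    obtain ⟨q, hq⟩ := List.exists_mem_of_ne_nil _ (f a).leaves_ne_nil
    exact hab hq hq
  · have : Std.Symm (Function.onFun List.Disjoint fun l => (f l).leaves) :=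
      ⟨fun _ _ h => List.Disjoint.symm h⟩
    exact h.2.forall hl hl' hne hq hq'

/-- Each leaf is the minimum of the tree replacing it, so every subtree keeps its smallest leaf
under substitution and the order at each vertex can be read off from the larger tree. -/
theorem IsCanonical.of_subst {t : LTree X} {f : ℕ → LTree X} (h : (t.subst f).IsCanonical)
    (hf : ∀ l ∈ t.leaves, (f l).minLeaf = l) : t.IsCanonical := by
  induction t with
  | leaf l => trivial
  | node x c ih =>
    have hm : ∀ i, ∀ l ∈ (c i).leaves, (f l).minLeaf = l :=
      fun i l hl => hf l (mem_leaves_node.2 ⟨i, hl⟩)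
    refine ⟨fun i => ih i (h.1 i) (hm i), fun i j hij => ?_⟩
    have := h.2 i j hij
    rwa [minLt_iff, minLeaf_subst (hm i), minLeaf_subst (hm j), ← minLt_iff] at this

theorem IsCanonical.of_subst_apply {t : LTree X} {f : ℕ → LTree X} (h : (t.subst f).IsCanonical) :
    ∀ l ∈ t.leaves, (f l).IsCanonical := by
  induction t with
  | leaf l => simpa [leaves, LTree.subst] using h
  | node x c ih =>
    intro l hl
    obtain ⟨i, hi⟩ := mem_leaves_node.1 hl
    exact ih i (h.1 i) l hi

theorem IsCanonical.relabel {t : LTree X} (ht : t.IsCanonical) {e : ℕ → ℕ}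
    (he : ∀ l ∈ t.leaves, ∀ l' ∈ t.leaves, l < l' → e l < e l') : (t.relabel e).IsCanonical :=
  ht.subst (fun _ _ => trivial) fun l hl l' hl' h => by
    simpa [minLt_iff] using he l hl l' hl' h

/-! ### Branches -/

theorem IsBranch.refl (t : LTree X) : t.IsBranch t := by
  cases t with
  | leaf l => rfl
  | node x c => exact Or.inl rfl

theorem IsBranch.trans {s t r : LTree X} (h : s.IsBranch t) (h' : t.IsBranch r) :
    s.IsBranch r := by
  induction r with
  | leaf l => rwa [show t = leaf l from h'] at h
  | node x c ih =>
    rcases h' with rfl | ⟨i, hi⟩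
    · exact h
    · exact Or.inr ⟨i, ih i hi⟩

theorem IsBranch.subst {s t : LTree X} (h : s.IsBranch t) (f : ℕ → LTree X) :
    (s.subst f).IsBranch (t.subst f) := by
  induction t with
  | leaf l =>
    rw [show s = leaf l from h]
    exact IsBranch.refl _
  | node x c ih =>
    rcases h with rfl | ⟨i, hi⟩
    · exact IsBranch.refl _
    · exact Or.inr ⟨i, ih i hi⟩

theorem IsBranch.vertices_le {s t : LTree X} (h : s.IsBranch t) : s.vertices ≤ t.vertices := by
  induction t with
  | leaf l => rw [show s = leaf l from h]
  | node x c ih =>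
    rcases h with rfl | ⟨i, hi⟩
    · exact le_rfl
    · have := Finset.single_le_sum (f := fun i => (c i).vertices) (fun _ _ => Nat.zero_le _)
        (Finset.mem_univ i)
      have := ih i hi
      simp only [vertices] at *
      omega

theorem IsBranch.leaf_iff {l : ℕ} {t : LTree X} : (leaf l).IsBranch t ↔ l ∈ t.leaves := by
  induction t with
  | leaf l' => simp [IsBranch, leaves]
  | node x c ih => simp [IsBranch, mem_leaves_node, ih]

/-- A branch `s` of a tree can be cut off: what remains has a leaf labelled by the smallest leaf
of `s` in its place. -/
theorem IsBranch.exists_subst_eq {s t : LTree X} (h : s.IsBranch t) (ht : t.leaves.Nodup) :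
    ∃ r : LTree X, s.minLeaf ∈ r.leaves ∧ t = r.subst (Function.update leaf s.minLeaf s) := by
  induction t with
  | leaf l =>
    rw [show s = leaf l from h]
    exact ⟨leaf l, by simp [leaves], by simp [LTree.subst]⟩
  | node x c ih =>
    rcases h with rfl | ⟨i, hi⟩
    · exact ⟨leaf (node x c).minLeaf, by simp [leaves], by simp [LTree.subst]⟩
    · rw [leaves, List.nodup_flatten] at ht
      have hd := List.pairwise_ofFn.1 ht.2
      obtain ⟨r, hr, he⟩ := ih i hi (ht.1 _ (by simp))
      have hmem : s.minLeaf ∈ (c i).leaves := by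
        rw [he]
        exact mem_leaves_subst.2 ⟨_, hr, by simpa using s.minLeaf_mem⟩
      refine ⟨node x (Function.update c i r), mem_leaves_node.2 ⟨i, by simpa using hr⟩, ?_⟩
      simp only [LTree.subst]
      congr 1
      funext j
      rcases eq_or_ne j i with rfl | hj
      · simpa using he
      -- The label of the cut occurs only in the child containing `s`, because leaves are distinct;
      -- the other children are untouched.
      · rw [Function.update_of_ne hj, subst_update_of_notMem]
        intro hmj
        rcases lt_or_gt_of_ne hj with h | h
        · exact hd h hmj hmem
        · exact hd h hmem hmj

end LTree

/-! ### Standardisation -/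

/-- The number of elements of `S` up to `l`. -/
def rank (S : Finset ℕ) (l : ℕ) : ℕ := (S.filter (· ≤ l)).card

theorem rank_mono (S : Finset ℕ) : Monotone (rank S) := fun _ _ h =>
  Finset.card_le_card fun _ hx => by
    rw [Finset.mem_filter] at hx ⊢
    exact ⟨hx.1, hx.2.trans h⟩

theorem rank_lt_rank {S : Finset ℕ} {l l' : ℕ} (h : l < l') (h' : l' ∈ S) :
    rank S l < rank S l' :=
  Finset.card_lt_card <| (Finset.ssubset_iff_of_subset fun x hx => by
    rw [Finset.mem_filter] at hx ⊢
    exact ⟨hx.1, hx.2.trans h.le⟩).2 ⟨l', by simp [h'], by simp [h]⟩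

theorem rank_strictMonoOn (S : Finset ℕ) : StrictMonoOn (rank S) S :=
  fun _ _ _ h' h => rank_lt_rank h h'

theorem rank_pos {S : Finset ℕ} {l : ℕ} (h : l ∈ S) : 1 ≤ rank S l :=
  Finset.card_pos.2 ⟨l, by simp [h]⟩

theorem rank_le_card (S : Finset ℕ) (l : ℕ) : rank S l ≤ S.card :=
  Finset.card_le_card (Finset.filter_subset _ _)

theorem image_rank (S : Finset ℕ) : S.image (rank S) = Finset.Icc 1 S.card := by
  refine Finset.eq_of_subset_of_card_le (fun k hk => ?_) ?_
  · obtain ⟨l, hl, rfl⟩ := Finset.mem_image.1 hk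
    exact Finset.mem_Icc.2 ⟨rank_pos hl, rank_le_card S l⟩
  · rw [Finset.card_image_of_injOn (rank_strictMonoOn S).injOn, Nat.card_Icc]
    omega

namespace LTree

variable {X : ℕ+ → Type u}

/-- The leaves of a tree, as a finite set. -/
def leafSet (t : LTree X) : Finset ℕ := t.leaves.toFinset

@[simp] theorem mem_leafSet {t : LTree X} {l : ℕ} : l ∈ t.leafSet ↔ l ∈ t.leaves :=
  List.mem_toFinset

/-- The tree with leaves renumbered by `1, …, n` in their order. -/
def std (t : LTree X) : LTree X := t.relabel (rank t.leafSet)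

theorem isMonomial_std {t : LTree X} (hc : t.IsCanonical) (hn : t.leaves.Nodup) :
    t.std.IsMonomial t.leafSet.card where
  canonical := hc.relabel fun l hl l' hl' h => rank_lt_rank h (mem_leafSet.2 hl')
  nodup := by
    rw [std, leaves_relabel]
    exact hn.map_on fun l hl l' hl' h =>
      (rank_strictMonoOn t.leafSet).injOn (mem_leafSet.2 hl) (mem_leafSet.2 hl') h
  mem_leaves k := by
    rw [← Finset.mem_Icc, ← image_rank, std, leaves_relabel]
    simp

/-- The standardisation of `t` as a tree monomial. -/
def toMonomial (t : LTree X) (hc : t.IsCanonical) (hn : t.leaves.Nodup) :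
    TreeMonomial X t.leafSet.card := ⟨t.std, isMonomial_std hc hn⟩

theorem toMonomial_val (t : LTree X) (hc : t.IsCanonical) (hn : t.leaves.Nodup) :
    (t.toMonomial hc hn).1 = t.relabel (rank t.leafSet) := rfl

/-- Regrafting a cut-off branch does not disturb the numbering by smallest descendants; this is what
makes the lower part of a cut canonical and a divisor. -/
theorem minLeaf_update_leaf (s : LTree X) (l : ℕ) :
    (Function.update leaf s.minLeaf s l).minLeaf = l := by
  rcases eq_or_ne l s.minLeaf with rfl | h
  · simp
  · simp [h]

end LTree

/-! ### Cutting a tree monomial along an edge -/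

namespace TreeMonomial

variable {X : ℕ+ → Type u} {n m : ℕ}

open LTree in
/-- A branch of a tree monomial can be cut off by an elementary shuffle composition. -/
theorem exists_eq_comp (a : TreeMonomial X n) {r s : LTree X} (hr : s.minLeaf ∈ r.leaves)
    (ha : a.1 = r.subst (Function.update leaf s.minLeaf s)) :
    ∃ (hrc : r.IsCanonical) (hrn : r.leaves.Nodup) (hsc : s.IsCanonical) (hsn : s.leaves.Nodup)
      (i : ℕ) (σ : Equiv.Perm ℕ) (_ : IsShuffle r.leafSet.card s.leafSet.card i σ),
      a.1 = (r.toMonomial hrc hrn).1.comp (s.toMonomial hsc hsn).1 s.leafSet.card i σ := by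
  obtain ⟨hcan, hnod, hmem⟩ := a.2
  rw [ha] at hcan hnod
  obtain ⟨hrn, hn2, hn3⟩ := nodup_of_nodup_subst hnod
  set p := s.minLeaf with hp
  have hrc : r.IsCanonical := hcan.of_subst fun l _ => minLeaf_update_leaf s l
  have hsc : s.IsCanonical := by simpa using hcan.of_subst_apply p hr
  have hsn : s.leaves.Nodup := by simpa using hn2 p hr
  have hdisj : ∀ l ∈ r.leaves, l ≠ p → l ∉ s.leaves := by
    intro l hl hlp
    have := hn3 l hl p hr hlp l (by simp [hlp, leaves])
    simpa using this
  have hcover : ∀ l, (1 ≤ l ∧ l ≤ n) ↔ (l ∈ r.leaves ∨ l ∈ s.leaves) := by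
    intro l
    rw [← hmem, ha, mem_leaves_subst]
    constructor
    · rintro ⟨l', hl', h⟩
      rcases eq_or_ne l' p with rfl | hne
      · exact Or.inr (by simpa using h)
      · rw [Function.update_of_ne hne, leaves, List.mem_singleton] at h
        exact Or.inl (h ▸ hl')
    · rintro (h | h)
      · rcases eq_or_ne l p with rfl | hne
        · exact ⟨_, h, by simpa using s.minLeaf_mem⟩
        · exact ⟨l, h, by simp [hne, leaves]⟩
      · exact ⟨p, hr, by simpa using h⟩
  have hps : p ∈ s.leaves := s.minLeaf_mem
  have hp1 : 1 ≤ p ∧ p ≤ n := (hcover p).2 (Or.inl hr)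
  have hmin : ∀ l ∈ s.leaves, p ≤ l := fun l hl => minLeaf_le hl
  set R := r.leafSet with hR
  set S := s.leafSet with hS
  have hRc : r.leafSet.card = R.card := rfl
  have hSc : s.leafSet.card = S.card := rfl
  have hsplit : n + 1 = R.card + S.card := by
    have h1 : R ∪ S = Finset.Icc 1 n := by
      ext l
      simp [R, S, hcover]
    have h2 : R ∩ S = {p} := by
      ext l
      simp only [Finset.mem_inter, Finset.mem_singleton, R, S, mem_leafSet]
      exact ⟨fun h => by_contra fun hne => hdisj l h.1 hne h.2, by rintro rfl; exact ⟨hr, hps⟩⟩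
    have := Finset.card_union_add_card_inter R S
    rw [h1, h2, Nat.card_Icc, Finset.card_singleton] at this
    omega
  -- the ranks of the elements up to `p`
  have hlow : ∀ l, l ≤ p → rank R l = l := by
    intro l hl
    rw [rank, show R.filter (· ≤ l) = Finset.Icc 1 l from ?_, Nat.card_Icc, Nat.add_sub_cancel]
    ext q
    simp only [Finset.mem_filter, Finset.mem_Icc, R, mem_leafSet]
    constructor
    · rintro ⟨hq, hql⟩
      exact ⟨((hcover q).2 (Or.inl hq)).1, hql⟩
    · rintro ⟨h1, h2⟩
      refine ⟨?_, h2⟩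
      rcases (hcover q).1 ⟨h1, by omega⟩ with h | h
      · exact h
      · have := hmin q h
        rw [show q = p by omega]
        exact hr
  have hsp : rank S p = 1 := by
    rw [rank, show S.filter (· ≤ p) = {p} from ?_, Finset.card_singleton]
    ext q
    simp only [Finset.mem_filter, Finset.mem_singleton, S, mem_leafSet]
    exact ⟨fun h => le_antisymm h.2 (hmin q h.1), by rintro rfl; exact ⟨hps, le_rfl⟩⟩
  classical
  -- This is the inverse of the required shuffle. The labels of `s` go in order to the block of
  -- length `S.card` starting at `p`, the labels of `r` above `p` go in order to the block after it,
  -- and everything else is fixed.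
  let g : ℕ → ℕ := fun l =>
    if l ∈ s.leaves then p + rank S l - 1
    else if l ∈ r.leaves ∧ p < l then rank R l + S.card - 1 else l
  have hgs : ∀ l ∈ s.leaves, g l = p + rank S l - 1 ∧ p ≤ g l ∧ g l ≤ p + S.card - 1 := by
    intro l hl
    have h1 : g l = p + rank S l - 1 := if_pos hl
    have h2 : 1 ≤ rank S l := rank_pos (mem_leafSet.2 hl)
    have h3 := rank_le_card S l
    omega
  have hgr : ∀ l ∈ r.leaves, p < l →
      g l = rank R l + S.card - 1 ∧ p + S.card ≤ g l ∧ g l ≤ n := by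
    intro l hl hpl
    have h1 : g l = rank R l + S.card - 1 := by
      simp only [g]
      rw [if_neg (hdisj l hl hpl.ne'), if_pos ⟨hl, hpl⟩]
    have h2 : rank R p < rank R l := rank_lt_rank hpl (mem_leafSet.2 hl)
    rw [hlow p le_rfl] at h2
    have h3 := rank_le_card R l
    omega
  have hglow : ∀ l, l < p → g l = l := by
    intro l hl
    simp only [g]
    rw [if_neg fun h => (hmin l h).not_gt hl, if_neg fun h => h.2.not_gt hl]
  have hgout : ∀ l, ¬ (1 ≤ l ∧ l ≤ n) → g l = l := by
    intro l hl
    rw [hcover, not_or] at hl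
    simp only [g]
    rw [if_neg hl.2, if_neg fun h => hl.1 h.1]
  have hcases : ∀ l, l ∈ s.leaves ∨ (l ∈ r.leaves ∧ p < l) ∨ (1 ≤ l ∧ l < p) ∨
      ¬ (1 ≤ l ∧ l ≤ n) := by
    intro l
    by_cases h : 1 ≤ l ∧ l ≤ n
    · rcases (hcover l).1 h with h' | h'
      · rcases lt_trichotomy l p with h2 | rfl | h2
        · exact Or.inr (Or.inr (Or.inl ⟨h.1, h2⟩))
        · exact Or.inl hps
        · exact Or.inr (Or.inl ⟨h', h2⟩)
      · exact Or.inl h'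
    · exact Or.inr (Or.inr (Or.inr h))
  have hpR : p ≤ R.card := by
    have := rank_le_card R p
    rwa [hlow p le_rfl] at this
  have hgS : ∀ l, p ≤ g l → g l ≤ p + S.card - 1 → l ∈ s.leaves := by
    intro l h1 h2
    rcases hcases l with h | ⟨h, h'⟩ | h | h
    · exact h
    · have := hgr l h h'
      omega
    · rw [hglow l h.2] at h1
      omega
    · rw [hgout l h] at h1 h2
      omega
  have hgR : ∀ l, p + S.card ≤ g l → g l ≤ n → l ∈ r.leaves ∧ p < l := by
    intro l h1 h2
    rcases hcases l with h | h | h | h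
    · have := hgs l h
      omega
    · exact h
    · rw [hglow l h.2] at h1
      omega
    · rw [hgout l h] at h1 h2
      omega
  have hinj : Function.Injective g := by
    intro l l' h
    rcases hcases l with h1 | ⟨h1, h1'⟩ | h1 | h1
    · have h2 := hgs l h1
      have h3 := hgS l' (by omega) (by omega)
      have h4 := hgs l' h3
      have h5 : 1 ≤ rank S l := rank_pos (mem_leafSet.2 h1)
      have h6 : 1 ≤ rank S l' := rank_pos (mem_leafSet.2 h3)
      exact (rank_strictMonoOn S).injOn (mem_leafSet.2 h1) (mem_leafSet.2 h3) (by omega)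
    · have h2 := hgr l h1 h1'
      have h3 := hgR l' (by omega) (by omega)
      have h4 := hgr l' h3.1 h3.2
      exact (rank_strictMonoOn R).injOn (mem_leafSet.2 h1) (mem_leafSet.2 h3.1) (by omega)
    · have h2 := hglow l h1.2
      rcases hcases l' with h3 | ⟨h3, h3'⟩ | h3 | h3
      · have := hgs l' h3
        omega
      · have := hgr l' h3 h3'
        omega
      · have := hglow l' h3.2
        omega
      · have := hgout l' h3
        omega
    · have h2 := hgout l h1
      rcases hcases l' with h3 | ⟨h3, h3'⟩ | h3 | h3
      · have := hgs l' h3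
        omega
      · have := hgr l' h3 h3'
        omega
      · have := hglow l' h3.2
        omega
      · have := hgout l' h3
        omega
  -- An injective self-map of `1, …, n` is onto, and outside this interval `g` is the identity.
  have hsurj : Function.Surjective g := by
    have himg : (Finset.Icc 1 n).image g = Finset.Icc 1 n := by
      refine Finset.eq_of_subset_of_card_le (fun k hk => ?_) ?_
      · obtain ⟨l, hl, rfl⟩ := Finset.mem_image.1 hk
        rw [Finset.mem_Icc] at hl ⊢
        rcases hcases l with h | ⟨h, h'⟩ | h | h
        · have := hgs l h
          omega
        · have := hgr l h h'
          omega
        · have := hglow l h.2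
          omega
        · exact absurd hl h
      · rw [Finset.card_image_of_injective _ hinj]
    intro k
    by_cases hk : 1 ≤ k ∧ k ≤ n
    · have : k ∈ (Finset.Icc 1 n).image g := himg.symm ▸ Finset.mem_Icc.2 hk
      obtain ⟨l, -, hl⟩ := Finset.mem_image.1 this
      exact ⟨l, hl⟩
    · exact ⟨k, hgout k hk⟩
  let e : Equiv.Perm ℕ := Equiv.ofBijective g ⟨hinj, hsurj⟩
  have heg : ∀ l, e.symm (g l) = l := fun l => e.symm_apply_apply l
  -- The composition takes place at index `p`, since `p` has rank `p` in `r`: all smaller labels lie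
  -- in `r`. The inverse of `g` is used because `LTree.comp` applies `σ` to positions and returns
  -- labels.
  refine ⟨hrc, hrn, hsc, hsn, p, e.symm, ⟨hp1.1, hpR, fun j hj => ?_, ?_, ?_⟩, ?_⟩
  · have h1 : g j = j := by
      rcases Nat.lt_or_ge j p with h | h
      · exact hglow j h
      · rcases eq_or_lt_of_le h with rfl | h
        · have := (hgs p hps).1
          omega
        · exact hgout j (by omega)
    calc e.symm j = e.symm (g j) := by rw [h1]
      _ = j := heg j
  · intro x hx y hy hxy
    obtain ⟨l, rfl⟩ := hsurj x
    obtain ⟨l', rfl⟩ := hsurj y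
    rw [heg, heg]
    rw [hSc, Set.mem_Icc] at hx hy
    have h1 := hgS l (by omega) (by omega)
    have h2 := hgS l' (by omega) (by omega)
    by_contra hcon
    have h3 := rank_mono S (not_lt.1 hcon)
    have h4 := hgs l h1
    have h5 := hgs l' h2
    omega
  · intro x hx y hy hxy
    obtain ⟨l, rfl⟩ := hsurj x
    obtain ⟨l', rfl⟩ := hsurj y
    rw [heg, heg]
    rw [hSc, Set.mem_Icc] at hx hy
    have h1 := hgR l (by omega) (by omega)
    have h2 := hgR l' (by omega) (by omega)
    by_contra hcon
    have h3 := rank_mono R (not_lt.1 hcon)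
    have h4 := hgr l h1.1 h1.2
    have h5 := hgr l' h2.1 h2.2
    omega
  · rw [ha]
    simp only [toMonomial, std, LTree.comp, relabel, subst_subst, LTree.subst, ← hR, ← hS]
    refine subst_congr fun l hl => ?_
    rcases lt_trichotomy l p with h | rfl | h
    · rw [Function.update_of_ne h.ne, hlow l h.le, if_pos h]
      have := heg l
      rw [hglow l h] at this
      rw [this]
    · rw [Function.update_self, hlow _ le_rfl, if_neg (lt_irrefl _), if_pos rfl]
      conv_lhs => rw [← s.subst_leaf]
      refine subst_congr fun q hq => ?_
      rw [← (hgs q hq).1, heg]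
    · have h1 := hgr l hl h
      have h2 : p < rank R l := by omega
      rw [Function.update_of_ne h.ne', if_neg h2.not_gt, if_neg h2.ne', ← h1.1, heg]

end TreeMonomial

end ShuffleOperad
namespace ShuffleOperad

namespace TreeMonomial

variable {X : ℕ+ → Type u} {n m p : ℕ}

open LTree

/-! ### Divisibility -/

/-- The arity is the largest leaf label. This allows equal underlying trees of formally different
arities to be identified. -/
theorem arity_eq {a : TreeMonomial X n} {b : TreeMonomial X m} (h : a.1 = b.1) : n = m := by
  have h1 := (a.2.mem_leaves n).2 ⟨a.pos, le_rfl⟩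
  have h2 := (b.2.mem_leaves m).2 ⟨b.pos, le_rfl⟩
  rw [h, b.2.mem_leaves] at h1
  rw [← h, a.2.mem_leaves] at h2
  omega

theorem Divides.refl (a : TreeMonomial X n) : a.Divides a :=
  ⟨leaf, by rw [subst_leaf]; exact IsBranch.refl _, fun j j' _ h _ => by simpa [minLt_iff] using h⟩

/-- The witnesses are composed by substitution. The leaves of the relevant `g j` must be located in
`1, …, m`, since the order of the trees `f l` is known only there. -/
theorem Divides.trans {c : TreeMonomial X p} {b : TreeMonomial X m} {a : TreeMonomial X n}
    (h : c.Divides b) (h' : b.Divides a) : c.Divides a := by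
  obtain ⟨g, hg, hg'⟩ := h
  obtain ⟨f, hf, hf'⟩ := h'
  have hmem : ∀ j, 1 ≤ j → j ≤ p → ∀ l ∈ (g j).leaves, 1 ≤ l ∧ l ≤ m := by
    intro j h1 h2 l hl
    rw [← b.2.mem_leaves]
    refine IsBranch.leaf_iff.1 (IsBranch.trans (IsBranch.leaf_iff.2 ?_) hg)
    exact mem_leaves_subst.2 ⟨j, (c.2.mem_leaves j).2 ⟨h1, h2⟩, hl⟩
  refine ⟨fun j => (g j).subst f, ?_, fun j j' h1 h2 h3 => ?_⟩
  · rw [← subst_subst]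
    exact (hg.subst f).trans hf
  · exact (hg' j j' h1 h2 h3).subst fun l hl l' hl' h =>
      hf' l l' (hmem j h1 (by omega) l hl).1 h (hmem j' (by omega) h3 l' hl').2

theorem Divides.vertices_le {b : TreeMonomial X m} {a : TreeMonomial X n} (h : b.Divides a) :
    b.vertices ≤ a.vertices := by
  obtain ⟨f, hf, -⟩ := h
  exact (vertices_le_subst _ f).trans hf.vertices_le

/-- Allows a divisor to be exhibited with its inherited labels. The choice function `e` below
inverts the renumbering, returning the leaf of a given rank. -/
theorem toMonomial_divides {t : LTree X} (hc : t.IsCanonical) (hn : t.leaves.Nodup)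
    {a : TreeMonomial X n} {f : ℕ → LTree X} (hf : (t.subst f).IsBranch a.1)
    (hlt : ∀ l ∈ t.leaves, ∀ l' ∈ t.leaves, l < l' → (f l).MinLt (f l')) :
    (t.toMonomial hc hn).Divides a := by
  have hex : ∀ k, ∃ l, 1 ≤ k → k ≤ t.leafSet.card → l ∈ t.leaves ∧ rank t.leafSet l = k := by
    intro k
    by_cases hk : k ∈ Finset.Icc 1 t.leafSet.card
    · rw [← image_rank] at hk
      obtain ⟨l, hl, h⟩ := Finset.mem_image.1 hk
      exact ⟨l, fun _ _ => ⟨mem_leafSet.1 hl, h⟩⟩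
    · exact ⟨0, fun h1 h2 => absurd (Finset.mem_Icc.2 ⟨h1, h2⟩) hk⟩
  choose e he using hex
  refine ⟨fun k => f (e k), ?_, fun j j' h1 h2 h3 => ?_⟩
  · rw [toMonomial_val, LTree.relabel, subst_subst]
    convert! hf using 1
    refine subst_congr fun l hl => ?_
    have h1 := he _ (rank_pos (mem_leafSet.2 hl)) (rank_le_card _ l)
    simp only [LTree.subst]
    rw [(rank_strictMonoOn t.leafSet).injOn (mem_leafSet.2 h1.1) (mem_leafSet.2 hl) h1.2]
  · have h4 := he j h1 (by omega)
    have h5 := he j' (by omega) h3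
    refine hlt _ h4.1 _ h5.1 ?_
    by_contra hcon
    have := rank_mono t.leafSet (not_lt.1 hcon)
    omega

/-! ### The number of vertices -/

/-- Among the substituted trees only the one at leaf `i` has vertices, and this leaf occurs once. -/
theorem vertices_comp (a : TreeMonomial X n) (b : TreeMonomial X m) {i : ℕ} {σ : Equiv.Perm ℕ}
    (h : IsShuffle n m i σ) : (a.comp b h).vertices = a.vertices + b.vertices := by
  simp only [vertices, comp, LTree.comp, vertices_subst, Nat.add_left_cancel_iff]
  rw [List.map_congr_left (g := fun j => if j = i then b.1.vertices else 0) fun j _ => ?_,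
    ← List.sum_toFinset _ a.2.nodup, Finset.sum_ite_eq', if_pos]
  · exact List.mem_toFinset.2 ((a.2.mem_leaves i).2 ⟨h.one_le, h.le⟩)
  · split_ifs <;> first | omega | simp [vertices_relabel, LTree.vertices]

theorem eq_leaf_of_vertices_eq_zero {a : TreeMonomial X n} (h : a.vertices = 0) :
    a.1 = leaf 1 := by
  obtain ⟨l, hl⟩ := LTree.eq_leaf_of_vertices_eq_zero h
  have h1 := (a.2.mem_leaves 1).2 ⟨le_rfl, a.pos⟩
  rw [hl, leaves, List.mem_singleton] at h1
  rw [hl, h1]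

/-- The tree without vertices. -/
def trivialTree (X : ℕ+ → Type u) : TreeMonomial X 1 :=
  ⟨leaf 1, trivial, by simp [leaves], fun l => by
    simp only [leaves, List.mem_singleton]
    omega⟩

theorem trivialTree_divides (a : TreeMonomial X n) : (trivialTree X).Divides a := by
  obtain ⟨l, hl⟩ := List.exists_mem_of_ne_nil _ a.1.leaves_ne_nil
  exact ⟨fun _ => leaf l, IsBranch.leaf_iff.2 hl, fun _ _ _ _ _ => by omega⟩

/-- A strictly increasing enumeration of `1, …, n` by `1, …, m` is the identity. -/
theorem eq_self_of_strictMonoOn {e : ℕ → ℕ}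
    (hlt : ∀ j j', 1 ≤ j → j < j' → j' ≤ m → e j < e j')
    (hmem : ∀ k, (1 ≤ k ∧ k ≤ n) ↔ ∃ j, (1 ≤ j ∧ j ≤ m) ∧ e j = k) :
    ∀ j, 1 ≤ j → j ≤ m → e j = j := by
  intro j
  induction j using Nat.strong_induction_on with
  | _ j ih =>
    intro h1 h2
    have h3 := (hmem (e j)).2 ⟨j, ⟨h1, h2⟩, rfl⟩
    rcases lt_trichotomy (e j) j with h | h | h
    · have h4 := ih (e j) h h3.1 (by omega)
      have h5 := hlt (e j) j h3.1 h h2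
      omega
    · exact h
    -- If `e j` overshoots `j`, the value `j` would have to be attained elsewhere. Smaller arguments
    -- are fixed by induction, and larger ones have values above `e j`.
    · obtain ⟨k, hk, hkj⟩ := (hmem j).1 ⟨h1, by omega⟩
      rcases lt_trichotomy k j with h4 | h4 | h4
      · have := ih k h4 hk.1 hk.2
        omega
      · subst h4
        omega
      · have := hlt j k h1 h4 hk.2
        omega

/-- If the trees substituted for the leaves of `b` are leaves in the right order, then the result
is `b`. -/
theorem eq_of_subst_leaves {b : TreeMonomial X m} {a : TreeMonomial X n} {f : ℕ → LTree X}
    (ha : b.1.subst f = a.1) (hf : ∀ j j', 1 ≤ j → j < j' → j' ≤ m → (f j).MinLt (f j'))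
    (hleaf : ∀ j ∈ b.1.leaves, ∃ l, f j = leaf l) : b.1 = a.1 := by
  have hfj : ∀ j ∈ b.1.leaves, f j = leaf (f j).minLeaf := by
    intro j hj
    obtain ⟨l, hl⟩ := hleaf j hj
    rw [hl, minLeaf_leaf]
  have he : ∀ j, 1 ≤ j → j ≤ m → (f j).minLeaf = j := by
    refine eq_self_of_strictMonoOn (n := n) (fun j j' h1 h2 h3 => minLt_iff.1 (hf j j' h1 h2 h3))
      fun k => ?_
    rw [← a.2.mem_leaves, ← ha, mem_leaves_subst]
    refine exists_congr fun j => ?_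
    rw [b.2.mem_leaves]
    refine and_congr_right fun hj => ?_
    rw [hfj j ((b.2.mem_leaves j).2 hj)]
    simp [leaves, eq_comm]
  rw [← ha]
  conv_lhs => rw [← b.1.subst_leaf]
  refine subst_congr fun j hj => ?_
  have h := (b.2.mem_leaves j).1 hj
  rw [hfj j hj, he j h.1 h.2]

theorem eq_corolla_of_vertices_eq_one {a : TreeMonomial X n} (h : a.vertices = 1) :
    ∃ (k : ℕ+) (x : X k), (corolla x).1 = a.1 := by
  obtain ⟨t, ht⟩ := a
  cases t with
  | leaf l => simp [vertices, LTree.vertices] at h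
  | @node k x c =>
    have hc : ∀ i, (c i).vertices = 0 := by
      simpa [vertices, LTree.vertices] using h
    -- Leaves of the corolla are numbered from one and inputs from zero, whence `j - 1`. The default
    -- `leaf 0` is never substituted for a leaf of the corolla.
    let f : ℕ → LTree X := fun j => if hj : j - 1 < k then c ⟨j - 1, hj⟩ else leaf 0
    have hf : ∀ (j : ℕ) (_ : 1 ≤ j) (hj' : j ≤ k), f j = c ⟨j - 1, by omega⟩ := by
      intro j _ hj'
      exact dif_pos (by omega)
    refine ⟨k, x, eq_of_subst_leaves (b := corolla x) (a := ⟨node x c, ht⟩) (f := f) ?_ ?_ ?_⟩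
    · simp only [corolla, LTree.subst]
      congr 1
      funext i
      rw [hf _ (by omega) (by omega)]
      simp
    · intro j j' h1 h2 h3
      rw [hf j h1 (by omega), hf j' (by omega) h3]
      exact ht.canonical.2 _ _ (by rw [Fin.mk_lt_mk]; omega)
    · intro j hj
      have h1 := ((corolla x).2.mem_leaves j).1 hj
      rw [hf j h1.1 h1.2]
      exact LTree.eq_leaf_of_vertices_eq_zero (hc _)

/-- A tree monomial with at least two vertices is an elementary composition of proper divisors. -/
theorem exists_eq_comp_of_two_le (a : TreeMonomial X n) (h : 2 ≤ a.vertices) :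
    ∃ (p q : ℕ) (b : TreeMonomial X p) (c : TreeMonomial X q) (i : ℕ) (σ : Equiv.Perm ℕ)
      (hσ : IsShuffle p q i σ), a.1 = (b.comp c hσ).1 ∧ b.Divides a ∧ c.Divides a ∧
        b.vertices < a.vertices ∧ c.vertices < a.vertices := by
  -- With at least two vertices, some input of the root is not a leaf; the tree is cut at that edge.
  obtain ⟨s, hs, hs0, hsa⟩ : ∃ s : LTree X, s.IsBranch a.1 ∧ 0 < s.vertices ∧
      s.vertices < a.vertices := by
    rw [vertices] at h ⊢
    cases ht : a.1 with
    | leaf l => simp [ht, LTree.vertices] at h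
    | node x c =>
      rw [ht, LTree.vertices] at h
      obtain ⟨i, -, hi⟩ := Finset.exists_ne_zero_of_sum_ne_zero
        (show ∑ i, (c i).vertices ≠ 0 by omega)
      refine ⟨c i, Or.inr ⟨i, IsBranch.refl _⟩, Nat.pos_of_ne_zero hi, ?_⟩
      have := Finset.single_le_sum (f := fun i => (c i).vertices) (fun _ _ => Nat.zero_le _)
        (Finset.mem_univ i)
      rw [LTree.vertices]
      omega
  obtain ⟨r, hr, ha⟩ := hs.exists_subst_eq a.2.nodup
  obtain ⟨hrc, hrn, hsc, hsn, i, σ, hσ, hcomp⟩ := a.exists_eq_comp hr ha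
  have hv : a.vertices = (r.toMonomial hrc hrn).vertices + (s.toMonomial hsc hsn).vertices := by
    rw [← vertices_comp _ _ hσ]
    exact congrArg LTree.vertices hcomp
  have hvs : (s.toMonomial hsc hsn).vertices = s.vertices := vertices_relabel _ _
  refine ⟨_, _, r.toMonomial hrc hrn, s.toMonomial hsc hsn, i, σ, hσ, hcomp, ?_, ?_, by omega,
    by omega⟩
  · refine toMonomial_divides hrc hrn (f := Function.update leaf s.minLeaf s)
      (by rw [← ha]; exact IsBranch.refl _) fun l _ l' _ hll => ?_
    rwa [minLt_iff, minLeaf_update_leaf, minLeaf_update_leaf]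
  · refine toMonomial_divides hsc hsn (by rwa [subst_leaf]) fun l _ l' _ hll => ?_
    rwa [minLt_iff, minLeaf_leaf, minLeaf_leaf]

/-! ### Insertion into a larger tree -/

/-- Maps between sets of tree monomials which are iterated elementary compositions with fixed tree
monomials. -/
inductive IsGraft : ∀ {m n : ℕ}, (TreeMonomial X m → TreeMonomial X n) → Prop
  | id {m : ℕ} : IsGraft fun a : TreeMonomial X m => a
  | comp_right {m n p i : ℕ} {σ : Equiv.Perm ℕ} {φ : TreeMonomial X m → TreeMonomial X n}
      (hφ : IsGraft φ) (b : TreeMonomial X p) (h : IsShuffle n p i σ) :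
      IsGraft fun a => (φ a).comp b h
  | comp_left {m n p i : ℕ} {σ : Equiv.Perm ℕ} {φ : TreeMonomial X m → TreeMonomial X n}
      (hφ : IsGraft φ) (b : TreeMonomial X p) (h : IsShuffle p n i σ) :
      IsGraft fun a => b.comp (φ a) h

/-- The case where `b` sits at the root, by induction on the vertices of `a`. A tree `f j` with a
vertex is split off as the upper factor of a composition and replaced by a leaf carrying its
smallest label, so the order of smallest leaves persists. When only leaves remain, their order
forces `a = b`. -/
theorem exists_isGraft_of_subst_eq (b : TreeMonomial X m) {a : TreeMonomial X n}
    {f : ℕ → LTree X} (ha : b.1.subst f = a.1)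
    (hf : ∀ j j', 1 ≤ j → j < j' → j' ≤ m → (f j).MinLt (f j')) :
    ∃ φ : TreeMonomial X m → TreeMonomial X n, IsGraft φ ∧ φ b = a := by
  induction hN : a.vertices using Nat.strong_induction_on generalizing n a f with
  | _ N ih =>
    by_cases hleaf : ∀ j ∈ b.1.leaves, ∃ l, f j = leaf l
    · have h := eq_of_subst_leaves ha hf hleaf
      obtain rfl := arity_eq h
      exact ⟨_, IsGraft.id, Subtype.ext h⟩
    push Not at hleaf
    obtain ⟨j, hj, hjl⟩ := hleaf
    obtain ⟨-, -, hdisj⟩ := nodup_of_nodup_subst (ha ▸ a.2.nodup)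
    have hr : (f j).minLeaf ∈ (b.1.subst (Function.update f j (leaf (f j).minLeaf))).leaves :=
      mem_leaves_subst.2 ⟨j, hj, by simp [leaves]⟩
    obtain ⟨hrc, hrn, hsc, hsn, i, σ, hσ, hcomp⟩ := a.exists_eq_comp hr (by
      rw [← ha, subst_subst]
      refine subst_congr fun l hl => ?_
      rcases eq_or_ne l j with rfl | hlj
      · simp [LTree.subst]
      · rw [Function.update_of_ne hlj, subst_update_of_notMem]
        exact hdisj j hj l hl hlj.symm _ (f j).minLeaf_mem)
    obtain rfl := arity_eq (a := a) (b := TreeMonomial.comp _ _ hσ) hcomp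
    have ha' : a = TreeMonomial.comp _ _ hσ := Subtype.ext hcomp
    subst ha'
    rw [vertices_comp] at hN
    have hpos : 0 < ((f j).toMonomial hsc hsn).vertices := by
      refine Nat.pos_of_ne_zero fun h0 => ?_
      obtain ⟨l, hl⟩ := LTree.eq_leaf_of_vertices_eq_zero
        ((vertices_relabel (f j) _).symm.trans h0)
      exact hjl l hl
    obtain ⟨φ, hφ, hφb⟩ := ih _ (by omega) (a := LTree.toMonomial _ hrc hrn)
      (by rw [toMonomial_val, LTree.relabel, subst_subst]) (fun k k' h1 h2 h3 => by
        have hk := (b.2.mem_leaves k).2 ⟨h1, by omega⟩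
        have hk' := (b.2.mem_leaves k').2 ⟨by omega, h3⟩
        refine MinLt.subst ?_ fun l hl l' hl' hll => ?_
        · have hmin : ∀ q, (Function.update f j (leaf (f j).minLeaf) q).minLeaf
              = (f q).minLeaf := by
            intro q
            rcases eq_or_ne q j with rfl | hq
            · simp
            · simp [hq]
          rw [minLt_iff, hmin, hmin, ← minLt_iff]
          exact hf k k' h1 h2 h3
        · rw [minLt_iff, minLeaf_leaf, minLeaf_leaf]
          exact rank_lt_rank hll (mem_leafSet.2 (mem_leaves_subst.2 ⟨k', hk', hl'⟩))) rfl
    exact ⟨_, hφ.comp_right (LTree.toMonomial _ hsc hsn) hσ, by simp only [hφb]⟩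

/-- The branch whose bottom is `b` is cut off, which accounts for one composition with `b` in the
upper factor; inside the branch `b` sits at the root and the previous case applies. -/
theorem Divides.exists_isGraft {b : TreeMonomial X m} {a : TreeMonomial X n} (h : b.Divides a) :
    ∃ φ : TreeMonomial X m → TreeMonomial X n, IsGraft φ ∧ φ b = a := by
  obtain ⟨f, hf, hlt⟩ := h
  obtain ⟨r, hr, ha⟩ := hf.exists_subst_eq a.2.nodup
  obtain ⟨hrc, hrn, hsc, hsn, i, σ, hσ, hcomp⟩ := a.exists_eq_comp hr ha
  obtain rfl := arity_eq (a := a) (b := TreeMonomial.comp _ _ hσ) hcomp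
  obtain ⟨φ, hφ, hφb⟩ := exists_isGraft_of_subst_eq b (a := LTree.toMonomial _ hsc hsn)
    (f := fun j => (f j).relabel (rank (b.1.subst f).leafSet))
    (by rw [toMonomial_val, LTree.relabel, subst_subst]; rfl) (fun k k' h1 h2 h3 => by
      have hk' := (b.2.mem_leaves k').2 ⟨by omega, h3⟩
      refine (hlt k k' h1 h2 h3).subst fun l hl l' hl' hll => ?_
      rw [minLt_iff, minLeaf_leaf, minLeaf_leaf]
      exact rank_lt_rank hll (mem_leafSet.2 (mem_leaves_subst.2 ⟨k', hk', hl'⟩)))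
  refine ⟨_, hφ.comp_left (r.toMonomial hrc hrn) hσ, ?_⟩
  simp only [hφb]
  exact (Subtype.ext hcomp).symm

/-! ### Monotonicity of elementary compositions -/

/-- The trees put in place of different leaves have disjoint labels, because `σ` is injective and
the corresponding positions are disjoint; then `subst_injective` applies. -/
theorem comp_right_injective (b : TreeMonomial X m) {i : ℕ} {σ : Equiv.Perm ℕ}
    (h : IsShuffle n m i σ) : Function.Injective fun a : TreeMonomial X n => a.comp b h := by
  intro a a' haa
  have hm := b.pos
  refine Subtype.ext (subst_injective (fun j j' q hq hq' => ?_) (congrArg Subtype.val haa))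
  have aux : ∀ j, q ∈ (if j < i then leaf (σ j)
      else if j = i then b.1.relabel fun l => σ (i + l - 1)
      else leaf (σ (j + m - 1)) : LTree X).leaves →
      ∃ p, q = σ p ∧ (j < i → p = j) ∧ (j = i → i ≤ p ∧ p ≤ i + m - 1) ∧
        (i < j → p = j + m - 1) := by
    intro j hq
    split_ifs at hq with h1 h2
    · exact ⟨j, by simpa [leaves] using hq, by omega, by omega, by omega⟩
    · rw [leaves_relabel] at hq
      obtain ⟨l, hl, rfl⟩ := List.mem_map.1 hq
      have hl := (b.2.mem_leaves l).1 hl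
      exact ⟨i + l - 1, rfl, by omega, by omega, by omega⟩
    · exact ⟨j + m - 1, by simpa [leaves] using hq, by omega, by omega, by omega⟩
  obtain ⟨p, rfl, hp⟩ := aux j hq
  obtain ⟨p', hpp, hp'⟩ := aux j' hq'
  have := σ.injective hpp
  omega

/-- The upper factor is recovered from what is substituted at leaf `i`, up to an injective
relabelling. -/
theorem comp_left_injective (a : TreeMonomial X n) {i : ℕ} {σ : Equiv.Perm ℕ}
    (h : IsShuffle n m i σ) : Function.Injective fun b : TreeMonomial X m => a.comp b h := by
  intro b b' hbb
  have h1 := eq_of_subst_eq (congrArg Subtype.val hbb) i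
    ((a.2.mem_leaves i).2 ⟨h.one_le, h.le⟩)
  simp only [lt_irrefl, if_false, if_true] at h1
  refine Subtype.ext (relabel_injective (fun l l' hll => ?_) h1)
  have := σ.injective hll
  have := h.one_le
  omega

/-- Admissibility provides only weak monotonicity; strictness comes from injectivity of composition
in each factor. -/
theorem IsGraft.lt {φ : TreeMonomial X m → TreeMonomial X n} (hφ : IsGraft φ)
    (ord : AdmissibleOrder X) {s t : TreeMonomial X m} (h : ord.lt ⟨m, s⟩ ⟨m, t⟩) :
    ord.lt ⟨n, φ s⟩ ⟨n, φ t⟩ := by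
  induction hφ with
  | id => exact h
  | comp_right _ b hσ ih =>
    refine ⟨ord.comp_le_comp _ _ _ _ hσ ih.1 (ord.le_refl _), fun heq => ih.2 ?_⟩
    rw [comp_right_injective b hσ (eq_of_heq (Sigma.mk.inj heq).2)]
  | comp_left _ b hσ ih =>
    refine ⟨ord.comp_le_comp _ _ _ _ hσ (ord.le_refl _) ih.1, fun heq => ih.2 ?_⟩
    rw [comp_left_injective b hσ (eq_of_heq (Sigma.mk.inj heq).2)]

end TreeMonomial

end ShuffleOperad
namespace ShuffleOperad

/-! ### Admissible orders -/

namespace AdmissibleOrder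

variable {X : ℕ+ → Type u} (ord : AdmissibleOrder X)

theorem lt_irrefl (a : Σ n, TreeMonomial X n) : ¬ ord.lt a a := fun h => h.2 rfl

theorem lt_of_le_of_lt {a b c : Σ n, TreeMonomial X n} (h : ord.le a b) (h' : ord.lt b c) :
    ord.lt a c :=
  ⟨ord.le_trans _ _ _ h h'.1, fun e => h'.2 (ord.le_antisymm _ _ h'.1 (e ▸ h))⟩

theorem exists_max {n : ℕ} (S : Finset (TreeMonomial X n)) (hS : S.Nonempty) :
    ∃ t ∈ S, ∀ s ∈ S, ord.le ⟨n, s⟩ ⟨n, t⟩ := by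
  classical
  induction hS using Finset.Nonempty.cons_induction with
  | singleton a => exact ⟨a, by simp, by simp [ord.le_refl]⟩
  | cons a S ha hS ih =>
    obtain ⟨t, ht, hmax⟩ := ih
    rcases ord.le_total ⟨n, a⟩ ⟨n, t⟩ with h | h
    · exact ⟨t, by simp [ht], by simpa using ⟨h, hmax⟩⟩
    · refine ⟨a, by simp, ?_⟩
      simpa [ord.le_refl] using fun s hs => ord.le_trans _ _ _ (hmax s hs) h

end AdmissibleOrder

section Linear

variable {K : Type v} [Field K] {X : ℕ+ → Type u} {n m : ℕ}

theorem exists_isLeadingTerm (ord : AdmissibleOrder X) {f : FreeOperad K X n} (hf : f ≠ 0) :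
    ∃ t, IsLeadingTerm ord f t :=
  ord.exists_max f.support (Finsupp.support_nonempty_iff.2 hf)

/-! ### Elementary compositions as linear maps -/

theorem FreeOperad.comp_eq_sum_right (f : FreeOperad K X n) (g : FreeOperad K X m) {i : ℕ}
    {σ : Equiv.Perm ℕ} (h : IsShuffle n m i σ) :
    f.comp g h = g.sum fun b d => d • Finsupp.mapDomain (fun a => a.comp b h) f := by
  rw [FreeOperad.comp, Finsupp.sum_comm]
  refine Finsupp.sum_congr fun b _ => ?_
  rw [Finsupp.mapDomain, Finsupp.smul_sum]
  exact Finsupp.sum_congr fun a _ => by rw [Finsupp.smul_single, smul_eq_mul, mul_comm]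

theorem FreeOperad.comp_eq_sum_left (f : FreeOperad K X n) (g : FreeOperad K X m) {i : ℕ}
    {σ : Equiv.Perm ℕ} (h : IsShuffle n m i σ) :
    f.comp g h = f.sum fun a c => c • Finsupp.mapDomain (fun b => a.comp b h) g := by
  rw [FreeOperad.comp]
  refine Finsupp.sum_congr fun a _ => ?_
  rw [Finsupp.mapDomain, Finsupp.smul_sum]
  exact Finsupp.sum_congr fun b _ => by rw [Finsupp.smul_single, smul_eq_mul]

theorem FreeOperad.comp_single (f : FreeOperad K X n) (b : TreeMonomial X m) {i : ℕ}
    {σ : Equiv.Perm ℕ} (h : IsShuffle n m i σ) :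
    f.comp (Finsupp.single b (1 : K)) h = Finsupp.mapDomain (fun a => a.comp b h) f := by
  rw [comp_eq_sum_right, Finsupp.sum_single_index (by simp), one_smul]

theorem FreeOperad.single_comp (a : TreeMonomial X n) (g : FreeOperad K X m) {i : ℕ}
    {σ : Equiv.Perm ℕ} (h : IsShuffle n m i σ) :
    FreeOperad.comp (Finsupp.single a (1 : K)) g h
      = Finsupp.mapDomain (fun b => a.comp b h) g := by
  rw [comp_eq_sum_left, Finsupp.sum_single_index (by simp), one_smul]

theorem OperadIdeal.mapDomain_mem (N : OperadIdeal K X)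
    {φ : TreeMonomial X m → TreeMonomial X n} (hφ : TreeMonomial.IsGraft φ) {f : FreeOperad K X m}
    (hf : f ∈ N.carrier m) : Finsupp.mapDomain φ f ∈ N.carrier n := by
  induction hφ with
  | id => exact (Finsupp.mapDomain_id (v := f)).symm ▸ hf
  | comp_right _ b h ih =>
    have := N.comp_mem_left h _ (Finsupp.single b 1) ih
    rwa [FreeOperad.comp_single, ← Finsupp.mapDomain_comp] at this
  | comp_left _ b h ih =>
    have := N.comp_mem_right h (Finsupp.single b 1) _ ih
    rwa [FreeOperad.single_comp, ← Finsupp.mapDomain_comp] at this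

/-- An ideal is determined by its behaviour under compositions with tree monomials. -/
noncomputable def OperadIdeal.ofMonomials (carrier : ∀ n, Submodule K (FreeOperad K X n))
    (hr : ∀ {n m i : ℕ} {σ : Equiv.Perm ℕ} (h : IsShuffle n m i σ) (f : FreeOperad K X n)
      (b : TreeMonomial X m), f ∈ carrier n →
      Finsupp.mapDomain (fun a => a.comp b h) f ∈ carrier (n + m - 1))
    (hl : ∀ {n m i : ℕ} {σ : Equiv.Perm ℕ} (h : IsShuffle n m i σ) (a : TreeMonomial X n)
      (g : FreeOperad K X m), g ∈ carrier m →
      Finsupp.mapDomain (fun b => a.comp b h) g ∈ carrier (n + m - 1)) : OperadIdeal K X where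
  carrier := carrier
  comp_mem_left h f g hf := by
    rw [FreeOperad.comp_eq_sum_right]
    exact Submodule.sum_mem _ fun b _ => Submodule.smul_mem _ _ (hr h f b hf)
  comp_mem_right h f g hg := by
    rw [FreeOperad.comp_eq_sum_left]
    exact Submodule.sum_mem _ fun a _ => Submodule.smul_mem _ _ (hl h a g hg)

/-- The intersection of two ideals. -/
noncomputable def OperadIdeal.inf (M N : OperadIdeal K X) : OperadIdeal K X where
  carrier n := M.carrier n ⊓ N.carrier n
  comp_mem_left h f g hf := ⟨M.comp_mem_left h f g hf.1, N.comp_mem_left h f g hf.2⟩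
  comp_mem_right h f g hg := ⟨M.comp_mem_right h f g hg.1, N.comp_mem_right h f g hg.2⟩

/-! ### Reduction to normal monomials -/

theorem mem_of_forall_single_mem {W : Submodule K (FreeOperad K X n)} {f : FreeOperad K X n}
    (h : ∀ t ∈ f.support, Finsupp.single t (1 : K) ∈ W) : f ∈ W := by
  rw [← f.sum_single]
  refine Submodule.sum_mem _ fun t ht => ?_
  rw [← mul_one (f t), ← smul_eq_mul, ← Finsupp.smul_single]
  exact W.smul_mem _ (h t ht)

/-- The reduction algorithm as a well-founded induction. A non-normal `t` is `φ s` with `s` the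
leading term of some `g`; the image of `g` under `φ` lies in `N`, and all its other terms are
smaller than `t`. The ideal `N` is arbitrary above `G`, which is used later to prove generation. -/
theorem single_mem_sup_supported (ord : AdmissibleOrder X) (hwf : WellFounded ord.lt)
    (N : OperadIdeal K X) {G : ∀ n, Set (FreeOperad K X n)}
    (hG : ∀ n, ∀ g ∈ G n, g ∈ N.carrier n) (t : TreeMonomial X n) :
    Finsupp.single t (1 : K) ∈ N.carrier n ⊔ Finsupp.supported K K
      {u | u ∈ normalMonomials ord G n ∧ ord.le ⟨n, u⟩ ⟨n, t⟩} := by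
  refine hwf.induction (C := fun x => Finsupp.single x.2 (1 : K) ∈ N.carrier x.1 ⊔
    Finsupp.supported K K {u | u ∈ normalMonomials ord G x.1 ∧ ord.le ⟨x.1, u⟩ x}) ⟨n, t⟩ ?_
  rintro ⟨n, t⟩ ih
  by_cases ht : t ∈ normalMonomials ord G n
  · exact Submodule.mem_sup_right (Finsupp.single_mem_supported K 1 ⟨ht, ord.le_refl _⟩)
  obtain ⟨m, g, hg, s, hs, hst⟩ := not_not.1 ht
  obtain ⟨φ, hφ, rfl⟩ := hst.exists_isGraft
  have hF := N.mapDomain_mem hφ (hG m g hg)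
  rw [← Finsupp.single_add_erase s g, Finsupp.mapDomain_add, Finsupp.mapDomain_single] at hF
  let W := N.carrier n ⊔ Finsupp.supported K K
    {u | u ∈ normalMonomials ord G n ∧ ord.le ⟨n, u⟩ ⟨n, φ s⟩}
  change Finsupp.single (φ s) (1 : K) ∈ W
  have hrest : Finsupp.mapDomain φ (g.erase s) ∈ W := by
    classical
    refine mem_of_forall_single_mem fun w hw => ?_
    obtain ⟨u, hu, rfl⟩ := Finset.mem_image.1 (Finsupp.mapDomain_support hw)
    rw [Finsupp.support_erase, Finset.mem_erase] at hu
    have hlt : ord.lt ⟨n, φ u⟩ ⟨n, φ s⟩ := hφ.lt ord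
      ⟨hs.2 u hu.2, fun e => hu.1 (eq_of_heq (Sigma.mk.inj e).2)⟩
    have hsub : {w | w ∈ normalMonomials ord G n ∧ ord.le ⟨n, w⟩ ⟨n, φ u⟩} ⊆
        {w | w ∈ normalMonomials ord G n ∧ ord.le ⟨n, w⟩ ⟨n, φ s⟩} :=
      fun w hw => ⟨hw.1, ord.le_trans _ _ _ hw.2 hlt.1⟩
    exact SetLike.le_def.1 (sup_le_sup_left (Finsupp.supported_mono hsub) _) (ih _ hlt)
  -- Only the leading part of the image of `g` is left, and its coefficient `g s` is invertible.
  have hmem : Finsupp.single (φ s) (g s) ∈ W := by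
    have := W.sub_mem (Submodule.mem_sup_left hF) hrest
    rwa [add_sub_cancel_right] at this
  have := W.smul_mem (g s)⁻¹ hmem
  rwa [Finsupp.smul_single, smul_eq_mul, inv_mul_cancel₀ (Finsupp.mem_support_iff.1 hs.1)] at this

/-- Reduction does not leave a set of monomials which is closed under passage to smaller ones. -/
theorem mem_sup_supported (ord : AdmissibleOrder X) (hwf : WellFounded ord.lt)
    (N : OperadIdeal K X) {G : ∀ n, Set (FreeOperad K X n)}
    (hG : ∀ n, ∀ g ∈ G n, g ∈ N.carrier n) {P : TreeMonomial X n → Prop}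
    (hP : ∀ u w, ord.le ⟨n, u⟩ ⟨n, w⟩ → P w → P u) {f : FreeOperad K X n}
    (hf : ∀ t ∈ f.support, P t) :
    ∃ y ∈ N.carrier n, ∃ z : FreeOperad K X n,
      (∀ t ∈ z.support, t ∈ normalMonomials ord G n ∧ P t) ∧ y + z = f := by
  have : f ∈ N.carrier n ⊔ Finsupp.supported K K {u | u ∈ normalMonomials ord G n ∧ P u} :=
    mem_of_forall_single_mem fun t ht => by
      have hsub : {w | w ∈ normalMonomials ord G n ∧ ord.le ⟨n, w⟩ ⟨n, t⟩} ⊆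
          {w | w ∈ normalMonomials ord G n ∧ P w} :=
        fun w hw => ⟨hw.1, hP _ _ hw.2 (hf t ht)⟩
      exact SetLike.le_def.1 (sup_le_sup_left (Finsupp.supported_mono hsub) _)
        (single_mem_sup_supported ord hwf N hG t)
  obtain ⟨y, hy, z, hz, h⟩ := Submodule.mem_sup.1 this
  exact ⟨y, hy, z, fun t ht => (Finsupp.mem_supported K z).1 hz ht, h⟩

/-- Independence in the quotient says that the span of `B` meets `M` trivially; generation says that
this span and `M` add up to the whole space. -/
theorem isQuotientBasis_iff {M : OperadIdeal K X} {B : ∀ n, Set (TreeMonomial X n)} :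
    IsQuotientBasis M B ↔ ∀ n,
      (∀ f ∈ M.carrier n, (∀ t ∈ f.support, t ∈ B n) → f = 0) ∧
      ∀ f : FreeOperad K X n, ∃ e : FreeOperad K X n, (∀ t ∈ e.support, t ∈ B n) ∧
        f - e ∈ M.carrier n := by
  refine forall_congr' fun n => ?_
  have hspan : Submodule.span K (Set.range fun b : B n =>
      (Finsupp.single (b : TreeMonomial X n) (1 : K))) = Finsupp.supported K K (B n) := by
    rw [Finsupp.supported_eq_span_single, Set.image_eq_range]
  have hli : LinearIndependent K
      (fun b : B n => Finsupp.single (b : TreeMonomial X n) (1 : K)) :=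
    (Finsupp.linearIndependent_single_one K (TreeMonomial X n)).comp _ Subtype.val_injective
  refine and_congr ?_ ?_
  · have h1 : LinearIndependent K (fun b : B n =>
        (M.carrier n).mkQ (Finsupp.single (b : TreeMonomial X n) (1 : K))) ↔
        Disjoint (Finsupp.supported K K (B n)) (M.carrier n) := by
      rw [← hspan]
      constructor
      · intro h
        have := Submodule.range_ker_disjoint (f := (M.carrier n).mkQ) h
        rwa [Submodule.ker_mkQ] at this
      · intro h
        exact hli.map (by rwa [Submodule.ker_mkQ])
    rw [h1, Submodule.disjoint_def]
    exact ⟨fun h f hf hB => h f ((Finsupp.mem_supported K f).2 hB) hf,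
      fun h f hB hf => h f hf ((Finsupp.mem_supported K f).1 hB)⟩
  · have h2 : Submodule.span K (Set.range fun b : B n =>
        (M.carrier n).mkQ (Finsupp.single (b : TreeMonomial X n) (1 : K)))
        = (Finsupp.supported K K (B n)).map (M.carrier n).mkQ := by
      rw [← hspan, Submodule.map_span, ← Set.range_comp]
      rfl
    rw [h2, Submodule.map_mkQ_eq_top, Submodule.eq_top_iff']
    refine forall_congr' fun f => ?_
    rw [Submodule.mem_sup]
    constructor
    · rintro ⟨y, hy, z, hz, rfl⟩
      exact ⟨z, (Finsupp.mem_supported K z).1 hz, by rwa [add_sub_cancel_right]⟩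
    · rintro ⟨e, he, hm⟩
      exact ⟨_, hm, e, (Finsupp.mem_supported K e).2 he, sub_add_cancel _ _⟩

theorem IsLeadingTerm.lt_of_mem_erase {ord : AdmissibleOrder X} {f : FreeOperad K X n}
    {t u : TreeMonomial X n} (h : IsLeadingTerm ord f t) (hu : u ∈ (f.erase t).support) :
    ord.lt ⟨n, u⟩ ⟨n, t⟩ := by
  classical
  rw [Finsupp.support_erase, Finset.mem_erase] at hu
  exact ⟨h.2 u hu.2, fun e => hu.1 (eq_of_heq (Sigma.mk.inj e).2)⟩

/-! ### Normal monomials of a Gröbner basis -/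

theorem IsGroebnerBasis.isTriangularBasis {ord : AdmissibleOrder X} (hwf : WellFounded ord.lt)
    {M : OperadIdeal K X} {G : ∀ n, Set (FreeOperad K X n)} {k : ℕ}
    (hG : IsGroebnerBasis ord M G)
    (hv : ∀ n, ∀ g ∈ G n, ∀ t, IsLeadingTerm ord g t → 2 ≤ t.vertices ∧ t.vertices ≤ k) :
    IsTriangularBasis ord M k (normalMonomials ord G) := by
  have hGM := hG.generates.1
  have hzero : ∀ n, ∀ f ∈ M.carrier n, (∀ t ∈ f.support, t ∈ normalMonomials ord G n) →
      f = 0 := by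
    intro n f hf hB
    by_contra h0
    obtain ⟨t, ht⟩ := exists_isLeadingTerm ord h0
    exact hB t ht.1 (hG.divides n f hf t ht)
  refine ⟨fun n x => ?_, isQuotientBasis_iff.2 fun n => ⟨hzero n, fun f => ?_⟩, ?_,
    fun n a => ⟨fun ha m b _ hba => ?_, fun h => ?_⟩⟩
  · rintro ⟨m, g, hg, s, hs, hsx⟩
    have h1 := hsx.vertices_le
    have h2 := (hv m g hg s hs).1
    simp only [TreeMonomial.corolla, TreeMonomial.vertices, LTree.vertices,
      Finset.sum_const_zero] at h1 h2
    omega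
  · obtain ⟨y, hy, z, hz, rfl⟩ := mem_sup_supported ord hwf M hGM (P := fun _ => True) (f := f)
      (fun _ _ _ _ => trivial) (fun _ _ => trivial)
    exact ⟨z, fun t ht => (hz t ht).1, by rwa [add_sub_cancel_right]⟩
  · intro n m i σ h a _ b _
    refine or_iff_not_imp_left.2 fun hnot f hf hfM t ht => ?_
    obtain ⟨y, hy, z, hz, hyz⟩ := mem_sup_supported ord hwf M hGM
      (P := fun u => ord.le ⟨_, u⟩ ⟨_, a.comp b h⟩) (f := Finsupp.single (a.comp b h) 1)
      (fun _ _ h h' => ord.le_trans _ _ _ h h')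
      (fun u hu => by
        rw [Finset.mem_singleton.1 (Finsupp.support_single_subset hu)]
        exact ord.le_refl _)
    -- The given expansion `f` and the reduced expansion `z` differ by an element of `M` supported
    -- on normal monomials, hence they agree and the bound known for `z` holds for `f`.
    have hfz : f - z = 0 := by
      classical
      refine hzero _ _ ?_ fun u hu => ?_
      · have := (M.carrier _).sub_mem hy hfM
        rwa [← hyz, show y - (y + z - f) = f - z by abel] at this
      · rcases Finset.mem_union.1 (Finsupp.support_sub hu) with h | h
        · exact hf u h
        · exact (hz u h).1
    rw [sub_eq_zero.1 hfz] at ht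
    refine ⟨(hz t ht).2, fun e => hnot ?_⟩
    rw [← eq_of_heq (Sigma.mk.inj e).2]
    exact (hz t ht).1
  · rintro ⟨p, g, hg, s, hs, hsb⟩
    exact ha ⟨p, g, hg, s, hs, hsb.trans hba⟩
  -- A leading term dividing `a` is itself a divisor with at most `k` vertices, and it is not normal
  -- because it divides itself.
  · rintro ⟨p, g, hg, s, hs, hsa⟩
    exact h p s (hv p g hg s hs).2 hsa ⟨p, g, hg, s, hs, .refl s⟩

/-! ### The Gröbner basis of a triangular basis -/

/-- A tree monomial which is not in `B`, while all its proper divisors are. -/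
def IsMinimalNonmember (B : ∀ n, Set (TreeMonomial X n)) (t : TreeMonomial X n) : Prop :=
  t ∉ B n ∧ ∀ m (b : TreeMonomial X m), b.Divides t → b.vertices < t.vertices → b ∈ B m

theorem exists_isMinimalNonmember {B : ∀ n, Set (TreeMonomial X n)} {a : TreeMonomial X n}
    (ha : a ∉ B n) : ∃ m, ∃ t : TreeMonomial X m, IsMinimalNonmember B t ∧ t.Divides a := by
  induction hN : a.vertices using Nat.strong_induction_on generalizing n a with
  | _ N ih =>
    by_cases h : IsMinimalNonmember B a
    · exact ⟨n, a, h, .refl a⟩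
    · simp only [IsMinimalNonmember, not_and, not_forall] at h
      obtain ⟨m, b, hba, hlt, hb⟩ := h ha
      obtain ⟨p, t, ht, htb⟩ := ih _ (hN ▸ hlt) hb rfl
      exact ⟨p, t, ht, htb.trans hba⟩

/-- The differences of the minimal tree monomials outside `B` and their expansions. -/
def minimalRelations (M : OperadIdeal K X) (B : ∀ n, Set (TreeMonomial X n)) (n : ℕ) :
    Set (FreeOperad K X n) :=
  {g | g ∈ M.carrier n ∧ ∃ t, IsMinimalNonmember B t ∧
    ∃ e : FreeOperad K X n, (∀ u ∈ e.support, u ∈ B n) ∧ g = Finsupp.single t 1 - e}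

namespace IsTriangularBasis

variable {ord : AdmissibleOrder X} {M : OperadIdeal K X} {k : ℕ}
  {B : ∀ n, Set (TreeMonomial X n)}

theorem mem_of_divides (hB : IsTriangularBasis ord M k B) {a : TreeMonomial X n}
    {b : TreeMonomial X m} (ha : a ∈ B n) (h : b.Divides a) : b ∈ B m :=
  (hB.mem_iff m b).2 fun p c hc hcb => (hB.mem_iff n a).1 ha p c hc (hcb.trans h)

/-- The local condition detects `t ∉ B` on a divisor with at most `k` vertices, and minimality
prevents this divisor from having fewer vertices than `t`. -/
theorem vertices_le (hB : IsTriangularBasis ord M k B) {t : TreeMonomial X n}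
    (ht : IsMinimalNonmember B t) : t.vertices ≤ k := by
  have h := ht.1
  rw [hB.mem_iff] at h
  push Not at h
  obtain ⟨m, b, hbk, hbt, hb⟩ := h
  exact (not_lt.1 fun hlt => hb (ht.2 m b hbt hlt)).trans hbk

/-- Triangularity speaks only of compositions of elements of `B`. It applies because `t` with at
least two vertices is a composition of proper divisors, which are in `B` by minimality. A corolla
cannot be outside `B`, and the trivial tree can be outside only if `B` is empty, since it divides
everything; then the expansion has no terms. -/
theorem lt_of_mem_support (hB : IsTriangularBasis ord M k B) {t : TreeMonomial X n}
    (ht : IsMinimalNonmember B t) {e : FreeOperad K X n} (he : ∀ u ∈ e.support, u ∈ B n)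
    (hM : Finsupp.single t 1 - e ∈ M.carrier n) {u : TreeMonomial X n} (hu : u ∈ e.support) :
    ord.lt ⟨n, u⟩ ⟨n, t⟩ := by
  rcases Nat.lt_or_ge t.vertices 2 with h2 | h2
  · exfalso
    rcases Nat.eq_zero_or_pos t.vertices with h0 | h0
    · have hleaf := TreeMonomial.eq_leaf_of_vertices_eq_zero h0
      obtain rfl := TreeMonomial.arity_eq (b := TreeMonomial.trivialTree X) hleaf
      have : t = TreeMonomial.trivialTree X := Subtype.ext hleaf
      exact ht.1 (this ▸ hB.mem_of_divides (he u hu) (TreeMonomial.trivialTree_divides u))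
    · obtain ⟨p, x, hx⟩ := TreeMonomial.eq_corolla_of_vertices_eq_one (a := t) (by omega)
      obtain rfl := TreeMonomial.arity_eq hx
      exact ht.1 (Subtype.ext hx ▸ hB.corolla_mem p x)
  · obtain ⟨p, q, b, c, i, σ, hσ, heq, hb, hc, hbv, hcv⟩ := t.exists_eq_comp_of_two_le h2
    obtain rfl := TreeMonomial.arity_eq heq
    obtain rfl : t = b.comp c hσ := Subtype.ext heq
    exact (hB.triangular p q i σ hσ b (ht.2 _ b hb hbv) c (ht.2 _ c hc hcv)).resolve_left ht.1
      e he hM u hu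

theorem isLeadingTerm_iff (hB : IsTriangularBasis ord M k B) {t : TreeMonomial X n}
    (ht : IsMinimalNonmember B t) {e : FreeOperad K X n} (he : ∀ u ∈ e.support, u ∈ B n)
    (hM : Finsupp.single t 1 - e ∈ M.carrier n) {s : TreeMonomial X n} :
    IsLeadingTerm ord (Finsupp.single t 1 - e) s ↔ s = t := by
  classical
  have hlead : IsLeadingTerm ord (Finsupp.single t 1 - e) t := by
    refine ⟨?_, fun s hs => ?_⟩
    · have : e t = 0 := Finsupp.notMem_support_iff.1 fun h => ht.1 (he t h)
      simp [this]
    · rcases Finset.mem_union.1 (Finsupp.support_sub hs) with h | h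
      · rw [Finset.mem_singleton.1 (Finsupp.support_single_subset h)]
        exact ord.le_refl _
      · exact (hB.lt_of_mem_support ht he hM h).1
  refine ⟨fun hs => ?_, fun h => h ▸ hlead⟩
  exact eq_of_heq (Sigma.mk.inj (ord.le_antisymm _ _ (hlead.2 s hs.1) (hs.2 t hlead.1))).2

theorem normalMonomials_minimalRelations (hB : IsTriangularBasis ord M k B) :
    normalMonomials ord (minimalRelations M B) = B := by
  funext n
  ext a
  constructor
  · intro ha
    by_contra hna
    obtain ⟨m, t, ht, hta⟩ := exists_isMinimalNonmember hna
    obtain ⟨e, he, heM⟩ := (isQuotientBasis_iff.1 hB.basis m).2 (Finsupp.single t 1)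
    exact ha ⟨m, _, ⟨heM, t, ht, e, he, rfl⟩, t, (hB.isLeadingTerm_iff ht he heM).2 rfl, hta⟩
  · rintro ha ⟨m, g, ⟨hgM, t, ht, e, he, rfl⟩, s, hs, hsa⟩
    rw [hB.isLeadingTerm_iff ht he hgM] at hs
    subst hs
    exact ht.1 (hB.mem_of_divides ha hsa)

/-- Both halves reduce an element of `M` to a remainder supported on `B`, which must vanish by
independence. -/
theorem isGroebnerBasis (hB : IsTriangularBasis ord M k B) (hwf : WellFounded ord.lt) :
    IsGroebnerBasis ord M (minimalRelations M B) := by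
  have hGM : ∀ n, ∀ g ∈ minimalRelations M B n, g ∈ M.carrier n := fun n g hg => hg.1
  have hzero := fun n => (isQuotientBasis_iff.1 hB.basis n).1
  refine ⟨⟨hGM, fun N hN n f hf => ?_⟩, fun n f hf t ht => ?_⟩
  -- Reducing modulo `M ∩ N` keeps the remainder in `M` while the subtracted part lies in `N`; as
  -- the remainder is zero, the element lies in `N`.
  · obtain ⟨y, hy, z, hz, rfl⟩ := mem_sup_supported ord hwf (M.inf N)
      (G := minimalRelations M B) (fun n g hg => ⟨hGM n g hg, hN n g hg⟩)
      (P := fun _ => True) (f := f) (fun _ _ _ _ => trivial) (fun _ _ => trivial)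
    rw [hB.normalMonomials_minimalRelations] at hz
    have : z = 0 := hzero n z (((M.carrier n).add_mem_iff_right hy.1).1 hf) fun t ht => (hz t ht).1
    rw [this, add_zero]
    exact hy.2
  · classical
    by_contra hnd
    have htB : t ∈ B n := by
      rw [← hB.normalMonomials_minimalRelations]
      exact hnd
    -- Only the tail of `f` is reduced. Its remainder has terms below `t`, so it cannot cancel the
    -- leading coefficient, although the sum of both must be zero if `t ∈ B`.
    obtain ⟨y, hy, z, hz, hyz⟩ := mem_sup_supported ord hwf M hGM
      (P := fun u => ord.lt ⟨n, u⟩ ⟨n, t⟩) (f := f.erase t)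
      (fun _ _ h h' => ord.lt_of_le_of_lt h h') (fun u hu => ht.lt_of_mem_erase hu)
    rw [hB.normalMonomials_minimalRelations] at hz
    rw [← Finsupp.single_add_erase t f, ← hyz, add_left_comm] at hf
    have h0 := hzero n _ (((M.carrier n).add_mem_iff_right hy).1 hf) fun u hu => by
      rcases Finset.mem_union.1 (Finsupp.support_add hu) with h | h
      · rwa [Finset.mem_singleton.1 (Finsupp.support_single_subset h)]
      · exact (hz u h).1
    have hzt : z t = 0 := Finsupp.notMem_support_iff.1 fun h => ord.lt_irrefl _ (hz t h).2
    have := DFunLike.congr_fun h0 t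
    simp only [Finsupp.add_apply, Finsupp.single_eq_same, hzt, add_zero,
      Finsupp.zero_apply] at this
    exact Finsupp.mem_support_iff.1 ht.1 this

theorem vertices_le_of_isLeadingTerm (hB : IsTriangularBasis ord M k B) {g : FreeOperad K X n}
    (hg : g ∈ minimalRelations M B n) {t : TreeMonomial X n} (h : IsLeadingTerm ord g t) :
    t.vertices ≤ k := by
  obtain ⟨hgM, t', ht, e, he, rfl⟩ := hg
  rw [hB.isLeadingTerm_iff ht he hgM] at h
  exact h ▸ hB.vertices_le ht

theorem vertices_le_of_mem_support (hB : IsTriangularBasis ord M k B)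
    (h : M.IsVertexHomogeneous ∨ ord.IsVertexGraded) {g : FreeOperad K X n}
    (hg : g ∈ minimalRelations M B n) {u : TreeMonomial X n} (hu : u ∈ g.support) :
    u.vertices ≤ k := by
  classical
  obtain ⟨hgM, t, ht, e, he, rfl⟩ := hg
  refine le_trans (not_lt.1 fun hlt => ?_) (hB.vertices_le ht)
  have hsupp : ∀ w ∈ (Finsupp.single t 1 - e).support, w ≠ t → w ∈ e.support := by
    intro w hw hwt
    rcases Finset.mem_union.1 (Finsupp.support_sub hw) with h | h
    · exact absurd (Finset.mem_singleton.1 (Finsupp.support_single_subset h)) hwt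
    · exact h
  rcases h with h | h
  -- The component of the relation in the degree of `u` does not involve `t`, which has fewer
  -- vertices. So it lies in `M` and is supported on `B`, hence vanishes.
  · obtain ⟨g', hg', hg'v⟩ := h n _ hgM u.vertices
    have h0 : g' = 0 := (isQuotientBasis_iff.1 hB.basis n).1 g' hg' fun w hw => by
      have hwv : w.vertices = u.vertices := by
        by_contra hne
        exact Finsupp.mem_support_iff.1 hw ((hg'v w).2 hne)
      refine he w (hsupp w ?_ ?_)
      · rw [Finsupp.mem_support_iff, ← (hg'v w).1 hwv]
        exact Finsupp.mem_support_iff.1 hw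
      · rintro rfl
        omega
    have := (hg'v u).1 rfl
    rw [h0] at this
    exact Finsupp.mem_support_iff.1 hu this.symm
  · have h1 := h n t u hlt
    have h2 := (hB.isLeadingTerm_iff ht he hgM).2 rfl
    exact h1.2 (ord.le_antisymm _ _ h1.1 (h2.2 u hu))

end IsTriangularBasis

/-! ### Quadratic operads -/

/-- The part of an element that consists of the tree monomials whose numbers of vertices
satisfy `p`. -/
noncomputable def vertexPart (K : Type v) [Field K] (X : ℕ+ → Type u) (n : ℕ) (p : Set ℕ) :
    FreeOperad K X n →ₗ[K] FreeOperad K X n :=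
  open Classical in
  (Finsupp.supported K K {t : TreeMonomial X n | t.vertices ∈ p}).subtype ∘ₗ
    Finsupp.restrictDom K K {t : TreeMonomial X n | t.vertices ∈ p}

open Classical in
theorem vertexPart_apply (p : Set ℕ) (f : FreeOperad K X n) (t : TreeMonomial X n) :
    vertexPart K X n p f t = if t.vertices ∈ p then f t else 0 := by
  simp [vertexPart, Finsupp.filter_apply]

open Classical in
theorem vertexPart_single (p : Set ℕ) (t : TreeMonomial X n) (c : K) :
    vertexPart K X n p (Finsupp.single t c)
      = if t.vertices ∈ p then Finsupp.single t c else 0 := by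
  ext s
  rw [vertexPart_apply]
  by_cases hst : t = s
  · subst hst
    split_ifs <;> simp
  · split_ifs <;> simp [Finsupp.single_eq_of_ne' hst]

/-- Composition shifts all vertex numbers by a constant. Selecting by a set of numbers instead of a
single one makes the preimage under the shift available without subtraction, even when it is empty.
-/
theorem vertexPart_mapDomain {φ : TreeMonomial X m → TreeMonomial X n} {d : ℕ}
    (hφ : ∀ a, (φ a).vertices = a.vertices + d) (p : Set ℕ) (f : FreeOperad K X m) :
    vertexPart K X n p (Finsupp.mapDomain φ f)
      = Finsupp.mapDomain φ (vertexPart K X m {j | j + d ∈ p} f) := by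
  classical
  induction f using Finsupp.induction_linear with
  | zero => simp
  | add f g hf hg => simp only [Finsupp.mapDomain_add, map_add, hf, hg]
  | single t c =>
    rw [Finsupp.mapDomain_single, vertexPart_single, vertexPart_single, hφ]
    simp only [Set.mem_ofPred_eq]
    split_ifs
    · rw [Finsupp.mapDomain_single]
    · rw [Finsupp.mapDomain_zero]

/-- The largest ideal contained in `M` which is homogeneous with respect to the number of
vertices. -/
noncomputable def OperadIdeal.homogeneousCore (M : OperadIdeal K X) : OperadIdeal K X :=
  .ofMonomials (fun n => ⨅ p, (M.carrier n).comap (vertexPart K X n p))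
    (fun {n m i σ} h f b hf => by
      simp only [Submodule.mem_iInf, Submodule.mem_comap] at hf ⊢
      intro p
      rw [vertexPart_mapDomain (d := b.vertices) (fun a => a.vertices_comp b h)]
      exact M.mapDomain_mem (.comp_right .id b h) (hf _))
    (fun {n m i σ} h a g hg => by
      simp only [Submodule.mem_iInf, Submodule.mem_comap] at hg ⊢
      intro p
      rw [vertexPart_mapDomain (d := a.vertices)
        (fun b => (a.vertices_comp b h).trans (add_comm _ _))]
      exact M.mapDomain_mem (.comp_left .id a h) (hg _))

theorem OperadIdeal.mem_homogeneousCore {M : OperadIdeal K X} {f : FreeOperad K X n} :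
    f ∈ M.homogeneousCore.carrier n ↔ ∀ p, vertexPart K X n p f ∈ M.carrier n := by
  simp [homogeneousCore, ofMonomials]

/-- Every part of a quadratic generator is the generator or zero, so the generators lie in the
homogeneous core, which is an ideal and thus contains `M`. -/
theorem OperadIdeal.IsQuadratic.isVertexHomogeneous {M : OperadIdeal K X} (hM : M.IsQuadratic) :
    M.IsVertexHomogeneous := by
  classical
  obtain ⟨R, hR, hRM⟩ := hM
  have hle := hRM.2 M.homogeneousCore fun n g hg => by
    rw [mem_homogeneousCore]
    intro p
    have : vertexPart K X n p g = if 2 ∈ p then g else 0 := by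
      ext t
      rw [vertexPart_apply]
      by_cases ht : t ∈ g.support
      · rw [hR n g hg t ht]
        split_ifs <;> rfl
      · rw [Finsupp.notMem_support_iff.1 ht, ite_self]
        split_ifs
        · exact (Finsupp.notMem_support_iff.1 ht).symm
        · rfl
    rw [this]
    split_ifs
    · exact hRM.1 n g hg
    · exact Submodule.zero_mem _
  intro n f hf d
  refine ⟨vertexPart K X n {d} f, mem_homogeneousCore.1 (hle n hf) _, fun t => ?_⟩
  rw [vertexPart_apply]
  exact ⟨fun h => if_pos h, fun h => if_neg h⟩

/-- The elements without tree monomials with fewer than two vertices form an ideal. -/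
noncomputable def decomposableIdeal (K : Type v) [Field K] (X : ℕ+ → Type u) : OperadIdeal K X :=
  .ofMonomials (fun n => Finsupp.supported K K {t : TreeMonomial X n | 2 ≤ t.vertices})
    (fun {n m i σ} h f b hf => by
      classical
      rw [Finsupp.mem_supported] at hf ⊢
      intro t ht
      obtain ⟨a, ha, rfl⟩ := Finset.mem_image.1 (Finsupp.mapDomain_support ht)
      have h1 : 2 ≤ a.vertices := hf ha
      have h2 := a.vertices_comp b h
      rw [Set.mem_ofPred_eq]
      omega)
    (fun {n m i σ} h a g hg => by
      classical
      rw [Finsupp.mem_supported] at hg ⊢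
      intro t ht
      obtain ⟨b, hb, rfl⟩ := Finset.mem_image.1 (Finsupp.mapDomain_support ht)
      have h1 : 2 ≤ b.vertices := hg hb
      have h2 := a.vertices_comp b h
      rw [Set.mem_ofPred_eq]
      omega)

theorem OperadIdeal.IsQuadratic.two_le_vertices {M : OperadIdeal K X} (hM : M.IsQuadratic)
    {f : FreeOperad K X n} (hf : f ∈ M.carrier n) {t : TreeMonomial X n} (ht : t ∈ f.support) :
    2 ≤ t.vertices := by
  obtain ⟨R, hR, hRM⟩ := hM
  have := hRM.2 (decomposableIdeal K X) (fun n g hg =>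
    (Finsupp.mem_supported K g).2 fun t ht => (hR n g hg t ht).ge) n hf
  exact (Finsupp.mem_supported K f).1 this ht

/-- The trivial tree divides every monomial; were it outside `B`, then `B` would be empty and the
trivial tree would lie in `M`, which has no terms with fewer than two vertices. -/
theorem IsTriangularBasis.trivialTree_mem {ord : AdmissibleOrder X} {M : OperadIdeal K X} {k : ℕ}
    {B : ∀ n, Set (TreeMonomial X n)} (hB : IsTriangularBasis ord M k B) (hM : M.IsQuadratic) :
    TreeMonomial.trivialTree X ∈ B 1 := by
  by_contra h
  obtain ⟨e, he, heM⟩ := (isQuotientBasis_iff.1 hB.basis 1).2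
    (Finsupp.single (TreeMonomial.trivialTree X) 1)
  have he0 : e = 0 := by
    rw [← Finsupp.support_eq_empty, Finset.eq_empty_iff_forall_notMem]
    exact fun u hu => h (hB.mem_of_divides (he u hu) (TreeMonomial.trivialTree_divides u))
  rw [he0, sub_zero] at heM
  have := hM.two_le_vertices heM (t := TreeMonomial.trivialTree X) (by simp)
  simp [TreeMonomial.trivialTree, TreeMonomial.vertices, LTree.vertices] at this

/-- The tree monomials with fewer than two vertices are the trivial tree and the corollas. -/
theorem mem_of_vertices_lt_two {B : ∀ n, Set (TreeMonomial X n)}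
    (hc : ∀ (n : ℕ+) (x : X n), TreeMonomial.corolla x ∈ B n)
    (h1 : TreeMonomial.trivialTree X ∈ B 1) {a : TreeMonomial X n} (ha : a.vertices < 2) :
    a ∈ B n := by
  rcases Nat.eq_zero_or_pos a.vertices with h0 | h0
  · have h := TreeMonomial.eq_leaf_of_vertices_eq_zero h0
    obtain rfl := TreeMonomial.arity_eq (b := TreeMonomial.trivialTree X) h
    rwa [show a = TreeMonomial.trivialTree X from Subtype.ext h]
  · obtain ⟨p, x, hx⟩ := TreeMonomial.eq_corolla_of_vertices_eq_one (a := a) (by omega)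
    obtain rfl := TreeMonomial.arity_eq hx
    exact Subtype.ext hx ▸ hc p x

theorem isPBWBasis_iff_isTriangularBasis (ord : AdmissibleOrder X) {M : OperadIdeal K X}
    (hM : M.IsQuadratic) (B : ∀ n, Set (TreeMonomial X n)) :
    IsPBWBasis ord M B ↔ IsTriangularBasis ord M 2 B := by
  have key : (∀ (n : ℕ+) (x : X n), TreeMonomial.corolla x ∈ B n) →
      TreeMonomial.trivialTree X ∈ B 1 → ∀ n (a : TreeMonomial X n),
      (∀ m (b : TreeMonomial X m), b.vertices ≤ 2 → b.Divides a → b ∈ B m) ↔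
      ∀ m (b : TreeMonomial X m), b.vertices = 2 → b.Divides a → b ∈ B m := by
    refine fun hc h1 n a => ⟨fun h m b hb => h m b hb.le, fun h m b hb hba => ?_⟩
    rcases hb.lt_or_eq with hb | hb
    · exact mem_of_vertices_lt_two hc h1 hb
    · exact h m b hb hba
  constructor
  · intro hB
    -- The trivial tree has no divisors with two vertices, so Hoffbeck's condition holds for it
    -- vacuously.
    have h1 : TreeMonomial.trivialTree X ∈ B 1 := (hB.mem_iff _ _).2 fun m b hb hd => by
      have := hd.vertices_le
      rw [hb] at this
      simp [TreeMonomial.trivialTree, TreeMonomial.vertices, LTree.vertices] at this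
    exact ⟨hB.corolla_mem, hB.basis, hB.triangular, fun n a =>
      (hB.mem_iff n a).trans (key hB.corolla_mem h1 n a).symm⟩
  · intro hB
    exact ⟨hB.corolla_mem, hB.basis, hB.triangular, fun n a =>
      (hB.mem_iff n a).trans (key hB.corolla_mem (hB.trivialTree_mem hM) n a)⟩

end Linear

end ShuffleOperad

/-! ### The main theorem -/

theorem mainTheorem3 {K : Type v} [Field K] {X : ℕ+ → Type u}
    (ord : ShuffleOperad.AdmissibleOrder X) (hwf : WellFounded ord.lt)
    (M : ShuffleOperad.OperadIdeal K X) :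
    (∀ (G : ∀ n, Set (ShuffleOperad.FreeOperad K X n)) (k : ℕ),
      ShuffleOperad.IsGroebnerBasis ord M G →
      (∀ n, ∀ g ∈ G n, ∀ t, ShuffleOperad.IsLeadingTerm ord g t →
        2 ≤ t.vertices ∧ t.vertices ≤ k) →
      ShuffleOperad.IsTriangularBasis ord M k (ShuffleOperad.normalMonomials ord G)) ∧
    (∀ (k : ℕ) (B : ∀ n, Set (ShuffleOperad.TreeMonomial X n)),
      ShuffleOperad.IsTriangularBasis ord M k B →
      ∃ G : ∀ n, Set (ShuffleOperad.FreeOperad K X n),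
        ShuffleOperad.IsGroebnerBasis ord M G ∧
        ShuffleOperad.normalMonomials ord G = B ∧
        (∀ n, ∀ g ∈ G n, ∀ t, ShuffleOperad.IsLeadingTerm ord g t → t.vertices ≤ k) ∧
        ((M.IsVertexHomogeneous ∨ ord.IsVertexGraded) →
          ∀ n, ∀ g ∈ G n, ∀ t ∈ g.support, t.vertices ≤ k)) ∧
    (M.IsQuadratic → ∀ B : ∀ n, Set (ShuffleOperad.TreeMonomial X n),
      (ShuffleOperad.IsPBWBasis ord M B ↔ ShuffleOperad.IsTriangularBasis ord M 2 B) ∧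
      (ShuffleOperad.IsPBWBasis ord M B ↔
        ∃ G : ∀ n, Set (ShuffleOperad.FreeOperad K X n),
          ShuffleOperad.IsGroebnerBasis ord M G ∧ ShuffleOperad.IsQuadraticSystem G ∧
          ShuffleOperad.normalMonomials ord G = B)) := by
  refine ⟨fun G k hG hv => hG.isTriangularBasis hwf hv, fun k B hB =>
    ⟨_, hB.isGroebnerBasis hwf, hB.normalMonomials_minimalRelations,
      fun n g hg t ht => hB.vertices_le_of_isLeadingTerm hg ht,
      fun h n g hg t ht => hB.vertices_le_of_mem_support h hg ht⟩, fun hM B => ?_⟩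
  have hiff := ShuffleOperad.isPBWBasis_iff_isTriangularBasis ord hM B
  refine ⟨hiff, hiff.trans ⟨fun hB => ?_, ?_⟩⟩
  -- Homogeneity bounds the vertices of all terms by two from above, and membership in a quadratic
  -- ideal bounds them by two from below.
  · exact ⟨_, hB.isGroebnerBasis hwf, fun n g hg t ht => le_antisymm
      (hB.vertices_le_of_mem_support (Or.inl hM.isVertexHomogeneous) hg ht)
      (hM.two_le_vertices hg.1 ht), hB.normalMonomials_minimalRelations⟩
  · rintro ⟨G, hG, hq, rfl⟩
    exact hG.isTriangularBasis hwf fun n g hg t ht =>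
      ⟨(hq n g hg t ht.1).ge, (hq n g hg t ht.1).le⟩
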